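/- Let $\delta\in\{1,-1\}$ and let $\mathcal N=\{X\in\mathbb R^{n\times n}: X^TX=I_n,\ \det X=\delta\}$, a smooth submanifold of $\mathbb R^{n\times n}$. A subset $S\subseteq\mathcal N$ is said to have codimension $c$ in $\mathcal N$ if $S$ is a finite disjoint union of smooth embedded submanifolds, all of dimension at most $\dim\mathcal N-c$, and at least one of them nonempty of dimension exactly $\dim\mathcal N-c$ (if $S$ is itself a nonempty submanifold, this means $\dim\mathcal N-\dim S=c$). A matrix is derogatory if one of its complex eigenvalues has geometric multiplicity greater than $1$; a double eigenvalue is a complex eigenvalue of algebraic multiplicity at least $2$. The set of derogatory matrices in $\mathcal N$ has codimension in $\mathcal N$ equal to - $1$ if $n\ge 2$ is even and $\delta=1$; - $3$ if $n\ge 4$ is even and $\delta=-1$; - $1$ if $n\ge 3$ is odd. Moreover, if $n$ is even, with $n\ge 4$ if $\delta=1$ and $n\ge 6$ if $\delta=-1$, then the set of matrices in $\mathcal N$ with at least one double nonreal eigenvalue has codimension $3$ in $\mathcal N$; and if $n\ge 3$ is odd, then the set of matrices in $\mathcal N$ with at least one double eigenvalue different from $-\delta$ has codimension $3$ in $\mathcal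 N$. -/

import Mathlib

open scoped ContDiff Matrix.Norms.Operator

/-- `M` is a smooth embedded submanifold of dimension `d` of the real normed space `E`: around each
of its points there is a smooth slice chart, i.e. a smooth diffeomorphism `φ` between open subsets
of `E` that carries `M` to a `d`-dimensional linear subspace. -/
def IsSmoothSubmanifold {E : Type*} [NormedAddCommGroup E] [NormedSpace ℝ E]
    (M : Set E) (d : ℕ) : Prop :=
  ∀ x ∈ M, ∃ (φ : OpenPartialHomeomorph E E) (V : Submodule ℝ E),
    x ∈ φ.source ∧
    ContDiffOn ℝ ∞ φ φ.source ∧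
    ContDiffOn ℝ ∞ φ.symm φ.target ∧
    Module.finrank ℝ V = d ∧
    ∀ y ∈ φ.source, y ∈ M ↔ φ y ∈ V

/-- The set `S` has codimension `c` in the smooth manifold `N` (both inside the normed space `E`):
`N` is a smooth submanifold of some dimension `D`, and `S ⊆ N` is a finite disjoint union of smooth
submanifolds, each of dimension at most `D - c`, and at least one of them nonempty of dimension
exactly `D - c`. When `S` is itself a nonempty smooth submanifold of dimension `d`, this says
`D - d = c`; in general it is the codimension of the top-dimensional strata. -/
def HasCodimIn {E : Type*} [NormedAddCommGroup E] [NormedSpace ℝ E]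
    (S N : Set E) (c : ℕ) : Prop :=
  S ⊆ N ∧ ∃ D : ℕ, IsSmoothSubmanifold N D ∧
    ∃ (ι : Type) (_ : Finite ι) (M : ι → Set E) (d : ι → ℕ),
      S = ⋃ i, M i ∧
      Pairwise (fun i j => Disjoint (M i) (M j)) ∧
      (∀ i, IsSmoothSubmanifold (M i) (d i)) ∧
      (∀ i, d i + c ≤ D) ∧
      ∃ i, (M i).Nonempty ∧ d i + c = D

/-- The real orthogonal `n × n` matrices of determinant `δ`. -/
def orthogonalWithDet (n : ℕ) (δ : ℝ) : Set (Matrix (Fin n) (Fin n) ℝ) :=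
  {X | X ∈ Matrix.orthogonalGroup (Fin n) ℝ ∧ X.det = δ}

/-- `X` is derogatory: some complex eigenvalue has geometric multiplicity greater than `1`. -/
def IsDerogatory {n : ℕ} (X : Matrix (Fin n) (Fin n) ℝ) : Prop :=
  ∃ z : ℂ, 1 < Module.finrank ℂ
    (Module.End.eigenspace (Matrix.toLin' (X.map (algebraMap ℝ ℂ))) z)

/-- The complex number `z` is a (at least) double eigenvalue of the real matrix `X`, i.e. a root of
multiplicity at least `2` of its characteristic polynomial. -/
def IsDoubleEigenvalue {n : ℕ} (X : Matrix (Fin n) (Fin n) ℝ) (z : ℂ) : Prop :=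
  2 ≤ (X.map (algebraMap ℝ ℂ)).charpoly.rootMultiplicity z

open Filter Topology Module.End

set_option linter.unusedSectionVars false

/-! Orthogonal matrices are normal, so over ℂ geometric and algebraic multiplicities agree and
"derogatory" means "has a double eigenvalue". The set in question is cut into strata on which dim
ℝ[X] and the number `skewCodim X` are constant. Near X, conjugations move in directions
complementary to the skew matrices commuting with X; multiplying X by the Cayley transform of a
small skew B that commutes with X keeps the eigenvalue coincidences exactly when B is a polynomial
in X. So the stratum of X has codimension `skewCodim X`, the dimension of the skew centralizer minus
that of the skew part of ℝ[X].

The key local fact is `exists_forall_commute_mem_adjoin`: if W is orthogonal, commutes with X and is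
close to X, then ℝ[X] ⊆ ℝ[W], so equality of dimensions forces equality of algebras. Together with
the parametrization `sliceParam` this gives `eventually_sliceParam_mem_stratum_iff`, hence slice
charts, and then `hasCodimIn_of_strata`. The Cayley transform replaces the exponential because it is
rational: it and its inverse preserve subalgebras.

If 1 and -1 have multiplicities p and q and the nonreal conjugate pairs have multiplicities m_i, the
codimension is p(p-1)/2 + q(q-1)/2 + ∑(m_i² - 1). Only bounds are needed. From below, copies of
so(p) or su(2) embed in the skew centralizer and meet ℝ[X] trivially; from above, explicit block
rotation matrices attain the value. A double real eigenvalue costs 1 and a double nonreal one costs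
3. The determinant can force the multiplicity of 1 or -1 to be odd; a multiple such eigenvalue is
then at least triple and also costs 3. -/

/-! ### Slice charts from local parametrizations -/

/-- A real-analytic local parametrization with invertible derivative, which identifies a subspace
with a set near a point, yields a slice chart for that set. -/
theorem exists_slice_chart {E : Type*} [NormedAddCommGroup E] [NormedSpace ℝ E] [CompleteSpace E]
    {Ψ : E → E} {L : E ≃L[ℝ] E} (hΨ : ContDiffAt ℝ ω Ψ 0)
    (hL : HasFDerivAt Ψ (L : E →L[ℝ] E) 0) {M : Set E} {V : Submodule ℝ E}
    (hV : ∀ᶠ Y in 𝓝 0, Ψ Y ∈ M ↔ Y ∈ V) :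
    ∃ φ : OpenPartialHomeomorph E E, Ψ 0 ∈ φ.source ∧ ContDiffOn ℝ ∞ φ φ.source ∧
      ContDiffOn ℝ ∞ φ.symm φ.target ∧ ∀ y ∈ φ.source, y ∈ M ↔ φ y ∈ V := by
  have hω : (ω : WithTop ℕ∞) ≠ 0 := by simp
  -- Order ω, unlike order ∞, passes from a point to a neighbourhood of it.
  have hω' : (ω : WithTop ℕ∞) ≠ ∞ := by simp
  set e := hΨ.toOpenPartialHomeomorph Ψ hL hω
  have he0 : (0 : E) ∈ e.source := hΨ.mem_toOpenPartialHomeomorph_source hL hω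
  have hinv : ContDiffAt ℝ ω e.symm (Ψ 0) := hΨ.to_localInverse hL hω
  obtain ⟨U, hU, hUo, hU0⟩ := eventually_nhds_iff.1 (hV.and (hΨ.eventually hω'))
  obtain ⟨W, hW, hWo, hW0⟩ := eventually_nhds_iff.1 (hinv.eventually hω')
  -- The chart is the local inverse of Ψ: U secures smoothness of Ψ and the slice property, W
  -- smoothness of the inverse.
  refine ⟨(e.restrOpen U hUo).symm.restrOpen W hWo, ?_, ?_, ?_, ?_⟩
  · refine ⟨?_, hW0⟩
    exact (e.restrOpen U hUo).map_source ⟨he0, hU0⟩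
  · intro y hy
    exact ((hW y hy.2).of_le (by simp)).contDiffWithinAt
  · intro y hy
    have hy' : y ∈ (e.restrOpen U hUo).source := hy.1
    exact ((hU y hy'.2).2.of_le (by simp)).contDiffWithinAt
  · intro y hy
    have hy1 : y ∈ (e.restrOpen U hUo).target := hy.1
    have hy2 := (e.restrOpen U hUo).map_target hy1
    have := (hU _ hy2.2).1
    change y ∈ M ↔ (e.restrOpen U hUo).symm y ∈ V
    rw [← this]
    have h3 : Ψ ((e.restrOpen U hUo).symm y) = y := (e.restrOpen U hUo).right_inv hy1
    rw [h3]

/-! ### Normal matrices: geometric equals algebraic multiplicity -/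

section Spectral

variable {ι : Type*} [Fintype ι] [DecidableEq ι] {𝕜 : Type*} [RCLike 𝕜]

open Matrix
open scoped ComplexOrder

/-- By normality N Nᴴ (N v) = Nᴴ N (N v) = 0, so Nᴴ N v = 0 and then N v = 0. -/
theorem Matrix.mulVec_eq_zero_of_commute_conjTranspose {N : Matrix ι ι 𝕜}
    (hN : Commute Nᴴ N) {v : ι → 𝕜} (hv : N *ᵥ (N *ᵥ v) = 0) : N *ᵥ v = 0 := by
  have h1 : (N * Nᴴ) *ᵥ (N *ᵥ v) = 0 := by
    rw [← hN.eq, ← mulVec_mulVec, hv, mulVec_zero]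
  rw [self_mul_conjTranspose_mulVec_eq_zero, mulVec_mulVec,
    conjTranspose_mul_self_mulVec_eq_zero] at h1
  exact h1

theorem Matrix.maxGenEigenspace_toLin'_eq_eigenspace {A : Matrix ι ι 𝕜}
    (hA : Commute Aᴴ A) (z : 𝕜) :
    maxGenEigenspace (toLin' A) z = eigenspace (toLin' A) z := by
  refine le_antisymm (fun v hv => ?_) ((genEigenspace _ z).mono le_top)
  obtain ⟨k, hk⟩ := (mem_maxGenEigenspace _ _ _).1 hv
  set N : Matrix ι ι 𝕜 := A - z • 1 with hNdef
  have hN : Commute Nᴴ N := by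
    have h1 : Nᴴ = Aᴴ - star z • 1 := by simp [hNdef]
    rw [h1]
    refine Commute.sub_left (Commute.sub_right hA ?_) (Commute.sub_right ?_ ?_)
    · exact (Commute.one_right _).smul_right z
    · exact (Commute.one_left _).smul_left _
    · exact ((Commute.one_left _).smul_left _).smul_right _
  have hlin : toLin' A - z • (1 : Module.End 𝕜 (ι → 𝕜)) = toLin' N := by
    rw [hNdef, map_sub, map_smul, toLin'_one]; rfl
  rw [hlin] at hk
  -- The previous lemma lowers the exponent one step at a time, so there are no Jordan blocks.
  have key : ∀ m, ((toLin' N) ^ (m + 1)) v = 0 → N *ᵥ v = 0 := by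
    intro m
    induction m with
    | zero => intro h; simpa using h
    | succ m ih =>
      intro h
      apply ih
      rw [← toLin'_pow, toLin'_apply] at h ⊢
      rw [pow_succ', ← mulVec_mulVec] at h ⊢
      rw [pow_succ', ← mulVec_mulVec] at h
      exact mulVec_eq_zero_of_commute_conjTranspose hN h
  have hv0 : N *ᵥ v = 0 := by
    rcases k with _ | k
    · have : v = 0 := by simpa using hk
      simp [this]
    · exact key k hk
  rw [mem_eigenspace_iff, toLin'_apply]
  have : A *ᵥ v - z • v = 0 := by
    rw [← hv0, hNdef, sub_mulVec, smul_mulVec, one_mulVec]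
  exact sub_eq_zero.1 this

theorem Matrix.finrank_eigenspace_eq_rootMultiplicity {A : Matrix ι ι 𝕜}
    (hA : Commute Aᴴ A) (z : 𝕜) :
    Module.finrank 𝕜 (eigenspace (toLin' A) z) = A.charpoly.rootMultiplicity z := by
  rw [← maxGenEigenspace_toLin'_eq_eigenspace hA, LinearMap.finrank_maxGenEigenspace_eq,
    Matrix.charpoly_toLin']

end Spectral

/-! ### Complex eigenvalues of real orthogonal matrices; polynomials in nearby commuting matrices -/

section Complexification

variable {ι : Type*} [Fintype ι] [DecidableEq ι]

open Matrix
open scoped ComplexOrder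

/-- The complexification of a real matrix. -/
noncomputable abbrev cpx (X : Matrix ι ι ℝ) : Matrix ι ι ℂ := X.map (algebraMap ℝ ℂ)

theorem cpx_eq_mapMatrix (X : Matrix ι ι ℝ) : cpx X = (algebraMap ℝ ℂ).mapMatrix X := rfl

theorem cpx_mul (X Y : Matrix ι ι ℝ) : cpx (X * Y) = cpx X * cpx Y := by
  simp only [cpx_eq_mapMatrix, map_mul]

theorem cpx_sub (X Y : Matrix ι ι ℝ) : cpx (X - Y) = cpx X - cpx Y := by
  simp only [cpx_eq_mapMatrix, map_sub]

theorem cpx_transpose (X : Matrix ι ι ℝ) : cpx Xᵀ = (cpx X)ᴴ := by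
  ext i j
  simp [cpx]

theorem cpx_pow (X : Matrix ι ι ℝ) (k : ℕ) : cpx (X ^ k) = cpx X ^ k := by
  simp only [cpx_eq_mapMatrix, map_pow]

theorem norm_cpx (X : Matrix ι ι ℝ) : ‖cpx X‖ = ‖X‖ := by
  rw [linfty_opNorm_def, linfty_opNorm_def]
  simp [cpx]

theorem mul_transpose_of_mem_orthogonalGroup {X : Matrix ι ι ℝ}
    (hX : X ∈ orthogonalGroup ι ℝ) : X * Xᵀ = 1 := by
  simpa [star_eq_conjTranspose] using (mem_orthogonalGroup_iff ι ℝ).1 hX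

theorem transpose_mul_of_mem_orthogonalGroup {X : Matrix ι ι ℝ}
    (hX : X ∈ orthogonalGroup ι ℝ) : Xᵀ * X = 1 := by
  simpa [star_eq_conjTranspose] using (mem_orthogonalGroup_iff' ι ℝ).1 hX

theorem mem_orthogonalGroup_of_mul_transpose {X : Matrix ι ι ℝ} (hX : X * Xᵀ = 1) :
    X ∈ orthogonalGroup ι ℝ := by
  rw [mem_orthogonalGroup_iff]
  simpa [star_eq_conjTranspose] using hX

theorem cpx_conjTranspose_mul_self {X : Matrix ι ι ℝ} (hX : X ∈ orthogonalGroup ι ℝ) :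
    (cpx X)ᴴ * cpx X = 1 := by
  rw [← cpx_transpose, ← cpx_mul, transpose_mul_of_mem_orthogonalGroup hX]
  simp

theorem cpx_commute_conjTranspose {X : Matrix ι ι ℝ} (hX : X ∈ orthogonalGroup ι ℝ) :
    Commute (cpx X)ᴴ (cpx X) := by
  have h := cpx_conjTranspose_mul_self hX
  exact h.trans (mul_eq_one_comm.1 h).symm

theorem commute_conjTranspose_of_mem_orthogonalGroup {X : Matrix ι ι ℝ}
    (hX : X ∈ orthogonalGroup ι ℝ) : Commute Xᴴ X := by
  have h := transpose_mul_of_mem_orthogonalGroup hX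
  rw [conjTranspose_eq_transpose_of_trivial]
  exact h.trans (mul_eq_one_comm.1 h).symm

/-- A common eigenvector is an eigenvector of X - Y for z - w, and an eigenvalue is bounded by the
operator norm. -/
theorem norm_eigenvalue_sub_le {X Y : Matrix ι ι ℝ} {v : ι → ℂ} (hv : v ≠ 0) {z w : ℂ}
    (hz : cpx X *ᵥ v = z • v) (hw : cpx Y *ᵥ v = w • v) : ‖z - w‖ ≤ ‖X - Y‖ := by
  have h : cpx (X - Y) *ᵥ v = (z - w) • v := by
    rw [cpx_sub, sub_mulVec, hz, hw, sub_smul]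
  have h2 := linfty_opNorm_mulVec (cpx (X - Y)) v
  rw [h, norm_smul, norm_cpx] at h2
  exact le_of_mul_le_mul_right h2 (norm_pos_iff.2 hv)

theorem norm_eigenvalue_eq_one {X : Matrix ι ι ℝ} (hX : X ∈ orthogonalGroup ι ℝ) {v : ι → ℂ}
    (hv : v ≠ 0) {z : ℂ} (hz : cpx X *ᵥ v = z • v) : ‖z‖ = 1 := by
  have h1 : star (cpx X *ᵥ v) ⬝ᵥ (cpx X *ᵥ v) = star v ⬝ᵥ v := by
    rw [star_mulVec, ← dotProduct_mulVec, mulVec_mulVec, cpx_conjTranspose_mul_self hX,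
      one_mulVec]
  have h0 : star v ⬝ᵥ v ≠ 0 := by
    rw [Ne, dotProduct_star_self_eq_zero]; exact hv
  rw [hz, star_smul, smul_dotProduct, dotProduct_smul, smul_smul, smul_eq_mul] at h1
  have h2 : star z * z = 1 := by
    apply mul_right_cancel₀ h0
    rw [h1, one_mul]
  have h3 : (‖z‖ : ℂ) ^ 2 = 1 := by
    rw [← Complex.conj_mul']; exact h2
  have h4 : ‖z‖ ^ 2 = 1 := by exact_mod_cast h3
  have := norm_nonneg z
  nlinarith

theorem eigenvalue_eq_one_or_neg_one {X : Matrix ι ι ℝ} (hX : X ∈ orthogonalGroup ι ℝ)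
    {v : ι → ℂ} (hv : v ≠ 0) {z : ℂ} (hz : cpx X *ᵥ v = z • v) (hr : z.im = 0) :
    z = 1 ∨ z = -1 := by
  have h1 := norm_eigenvalue_eq_one hX hv hz
  have h2 : z = (z.re : ℂ) := by apply Complex.ext <;> simp [hr]
  rw [h2, Complex.norm_real, Real.norm_eq_abs] at h1
  rcases eq_or_eq_neg_of_abs_eq h1 with h | h
  · left; rw [h2, h]; simp
  · right; rw [h2, h]; simp

/-- As X and Y are real, taking real parts of the coefficients of p preserves the relation. -/
theorem mem_adjoin_of_cpx_mem_adjoin {X Y : Matrix ι ι ℝ} {p : Polynomial ℂ}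
    (h : Polynomial.aeval (cpx X) p = cpx Y) : Y ∈ Algebra.adjoin ℝ {X} := by
  have hY : Y = ∑ i ∈ Finset.range (p.natDegree + 1), (p.coeff i).re • X ^ i := by
    ext a b
    have := congrArg (fun M : Matrix ι ι ℂ => (M a b).re) h
    rw [Polynomial.aeval_eq_sum_range] at this
    simp only [← cpx_pow, Matrix.sum_apply, Matrix.smul_apply, Complex.re_sum] at this
    simp only [Matrix.sum_apply, Matrix.smul_apply]
    simpa [cpx] using this.symm
  rw [hY]
  exact Subalgebra.sum_mem _ fun i _ => Subalgebra.smul_mem _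
    (pow_mem (Algebra.self_mem_adjoin_singleton ℝ X) i) _

theorem aeval_mulVec_of_eigenvector {𝕜 : Type*} [Field 𝕜] {A : Matrix ι ι 𝕜} {v : ι → 𝕜} {z : 𝕜}
    (h : A *ᵥ v = z • v) (p : Polynomial 𝕜) :
    (Polynomial.aeval A p) *ᵥ v = p.eval z • v := by
  induction p using Polynomial.induction_on' with
  | add p q hp hq => rw [map_add, add_mulVec, hp, hq, Polynomial.eval_add, add_smul]
  | monomial k a =>
    have hk : ∀ k : ℕ, (A ^ k) *ᵥ v = z ^ k • v := by
      intro k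
      induction k with
      | zero => simp
      | succ k ih => rw [pow_succ', ← mulVec_mulVec, ih, mulVec_smul, h, smul_smul, pow_succ]
    rw [Polynomial.aeval_monomial, Polynomial.eval_monomial, Algebra.algebraMap_eq_smul_one,
      smul_mul_assoc, one_mul, smul_mulVec, hk, smul_smul]

/-- Membership in the real algebra generated by `X` gives a polynomial relation between complex
eigenvalues. -/
theorem exists_polynomial_of_mem_adjoin {X Y : Matrix ι ι ℝ} (h : Y ∈ Algebra.adjoin ℝ {X}) :
    ∃ p : Polynomial ℝ, ∀ (z : ℂ) (v : ι → ℂ), cpx X *ᵥ v = z • v →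
      cpx Y *ᵥ v = Polynomial.aeval z p • v := by
  rw [Algebra.adjoin_singleton_eq_range_aeval] at h
  obtain ⟨p, rfl⟩ := h
  refine ⟨p, fun z v hv => ?_⟩
  have h1 : cpx (Polynomial.aeval X p) = Polynomial.aeval (cpx X) (p.map (algebraMap ℝ ℂ)) := by
    rw [Polynomial.aeval_map_algebraMap]
    exact (Polynomial.aeval_algHom_apply (Algebra.ofId ℝ ℂ).mapMatrix X p).symm
  change cpx (Polynomial.aeval X p) *ᵥ v = _
  rw [h1, aeval_mulVec_of_eigenvector hv, Polynomial.eval_map_algebraMap]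

theorem exists_separation_of_finite {s : Set ℂ} (hs : s.Finite) :
    ∃ ε > 0, ∀ z ∈ s, ∀ w ∈ s, ‖z - w‖ < ε → z = w := by
  rcases s.subsingleton_or_nontrivial with h | h
  · exact ⟨1, one_pos, fun z hz w hw _ => h hz hw⟩
  · refine ⟨s.infsep, hs.infsep_pos_iff_nontrivial.2 h, fun z hz w hw hzw => ?_⟩
    by_contra hne
    have := Set.infsep_le_dist_of_mem hz hw hne
    rw [dist_eq_norm] at this
    exact absurd hzw (not_lt.2 this)

/-- An orthogonal matrix is a polynomial in every orthogonal matrix that commutes with it and is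
close enough to it. -/
theorem exists_forall_commute_mem_adjoin {X : Matrix ι ι ℝ} (hX : X ∈ orthogonalGroup ι ℝ) :
    ∃ ε > 0, ∀ Y ∈ orthogonalGroup ι ℝ, Commute X Y → ‖Y - X‖ < ε →
      X ∈ Algebra.adjoin ℝ {Y} := by
  obtain ⟨ε, hε, hsep⟩ := exists_separation_of_finite (finite_hasEigenvalue (toLin' (cpx X)))
  -- ε separates the eigenvalues of X; two of them paired with the same eigenvalue of Y each lie
  -- within ε/2 of it, so they coincide.
  refine ⟨ε / 2, half_pos hε, fun Y hY hXY hlt => ?_⟩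
  have hs := finite_hasEigenvalue (toLin' (cpx Y))
  classical
  -- g sends an eigenvalue of Y to the eigenvalue of X on the same joint eigenvector. Interpolating
  -- g gives p with p(Y) = X, checked on joint eigenspaces; the default 0 is never used there.
  let g : ℂ → ℂ := fun w => if h : ∃ z, ∃ v : ι → ℂ, v ≠ 0 ∧ cpx X *ᵥ v = z • v ∧
    cpx Y *ᵥ v = w • v then h.choose else 0
  have hev : ∀ {A : Matrix ι ι ℂ} {v : ι → ℂ} {z : ℂ}, v ≠ 0 → A *ᵥ v = z • v →
      HasEigenvalue (toLin' A) z := fun {A v z} hv h =>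
    hasEigenvalue_of_hasEigenvector (x := v) ⟨by rw [mem_eigenspace_iff, toLin'_apply, h], hv⟩
  have hg : ∀ (z w : ℂ) (v : ι → ℂ), v ≠ 0 → cpx X *ᵥ v = z • v → cpx Y *ᵥ v = w • v →
      g w = z := by
    intro z w v hv hz hw
    have h : ∃ z, ∃ v : ι → ℂ, v ≠ 0 ∧ cpx X *ᵥ v = z • v ∧ cpx Y *ᵥ v = w • v :=
      ⟨z, v, hv, hz, hw⟩
    have hgw : g w = h.choose := dif_pos h
    obtain ⟨v', hv', hz', hw'⟩ := h.choose_spec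
    rw [hgw]
    refine hsep _ (hev hv' hz') _ (hev hv hz) ?_
    have h1 := norm_eigenvalue_sub_le hv hw hz
    have h2 := norm_eigenvalue_sub_le hv' hw' hz'
    calc ‖h.choose - z‖ = ‖(w - z) - (w - h.choose)‖ := by congr 1; ring
      _ ≤ ‖w - z‖ + ‖w - h.choose‖ := norm_sub_le _ _
      _ < ε := by linarith
  set p := Lagrange.interpolate hs.toFinset id g
  apply mem_adjoin_of_cpx_mem_adjoin (p := p)
  have htop := iSup_iInf_maxGenEigenspace_eq_top_of_iSup_maxGenEigenspace_eq_top_of_commute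
    (fun b : Bool => toLin' (cond b (cpx X) (cpx Y))) (by
      have hc : Commute (cpx X) (cpx Y) := by
        rw [commute_iff_eq, ← cpx_mul, ← cpx_mul, hXY.eq]
      have hc' := hc.map (toLinAlgEquiv' : Matrix ι ι ℂ ≃ₐ[ℂ] _)
      rintro (_ | _) (_ | _) hne
      · exact absurd rfl hne
      · exact hc'.symm
      · exact hc'
      · exact absurd rfl hne) (fun b => iSup_maxGenEigenspace_eq_top _)
  apply mulVec_injective
  funext v
  have hv : v ∈ ⨆ χ : Bool → ℂ,
      ⨅ b, maxGenEigenspace (toLin' (cond b (cpx X) (cpx Y))) (χ b) := by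
    rw [htop]; trivial
  refine Submodule.iSup_induction _
    (motive := fun v => (Polynomial.aeval (cpx Y) p) *ᵥ v = cpx X *ᵥ v) hv ?_ (by simp) ?_
  · intro χ v hv
    by_cases hv0 : v = 0
    · simp [hv0]
    rw [Submodule.mem_iInf] at hv
    have h1 := hv true
    have h2 := hv false
    simp only [cond_true, cond_false] at h1 h2
    rw [maxGenEigenspace_toLin'_eq_eigenspace (cpx_commute_conjTranspose hX),
      mem_eigenspace_iff, toLin'_apply] at h1
    rw [maxGenEigenspace_toLin'_eq_eigenspace (cpx_commute_conjTranspose hY),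
      mem_eigenspace_iff, toLin'_apply] at h2
    rw [aeval_mulVec_of_eigenvector h2, h1]
    congr 1
    have := Lagrange.eval_interpolate_at_node (s := hs.toFinset) (v := id) g
      (Set.injOn_id _) (i := χ false) (by simpa using hev hv0 h2)
    rw [← hg _ _ v hv0 h1 h2, ← this]
    rfl
  · intro x y hx hy
    rw [mulVec_add, mulVec_add, hx, hy]

end Complexification

/-! ### The Cayley transform -/

section Cayley

variable {ι : Type*} [Fintype ι] [DecidableEq ι]

open Matrix

/-- The Cayley transform. -/
noncomputable def cayley (B : Matrix ι ι ℝ) : Matrix ι ι ℝ := (1 - B)⁻¹ * (1 + B)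

/-- For skew B the form v ⬝ᵥ B v vanishes, so B v = v forces v = 0. -/
theorem isUnit_one_sub_of_skew {B : Matrix ι ι ℝ} (hB : Bᵀ = -B) : IsUnit (1 - B) := by
  rw [isUnit_iff_isUnit_det, isUnit_iff_ne_zero]
  intro h
  obtain ⟨v, hv, h0⟩ := exists_mulVec_eq_zero_iff.2 h
  have h1 : B *ᵥ v = v := by
    rw [sub_mulVec, one_mulVec, sub_eq_zero] at h0
    exact h0.symm
  have h2 : v ⬝ᵥ (B *ᵥ v) = -(v ⬝ᵥ (B *ᵥ v)) := by
    conv_lhs => rw [dotProduct_mulVec, ← mulVec_transpose, hB, neg_mulVec, neg_dotProduct,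
      dotProduct_comm]
  rw [h1] at h2
  exact hv (dotProduct_self_eq_zero.1 (by linarith))

theorem isUnit_one_add_of_skew {B : Matrix ι ι ℝ} (hB : Bᵀ = -B) : IsUnit (1 + B) := by
  have := isUnit_one_sub_of_skew (B := -B) (by rw [transpose_neg, hB])
  rwa [sub_neg_eq_add] at this

theorem cayley_zero : cayley (0 : Matrix ι ι ℝ) = 1 := by simp [cayley]

theorem one_sub_mul_cayley {B : Matrix ι ι ℝ} (hB : IsUnit (1 - B)) :
    (1 - B) * cayley B = 1 + B := by
  rw [cayley, mul_nonsing_inv_cancel_left _ _ ((isUnit_iff_isUnit_det _).1 hB)]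

theorem cayley_mul_cayley_neg {B : Matrix ι ι ℝ} (hB : Bᵀ = -B) :
    cayley B * cayley (-B) = 1 := by
  have h1 := (isUnit_iff_isUnit_det _).1 (isUnit_one_sub_of_skew hB)
  have h2 := (isUnit_iff_isUnit_det _).1 (isUnit_one_add_of_skew hB)
  rw [cayley, cayley, sub_neg_eq_add, ← sub_eq_add_neg, mul_assoc,
    mul_nonsing_inv_cancel_left _ _ h2, nonsing_inv_mul _ h1]

theorem transpose_cayley {B : Matrix ι ι ℝ} (hB : Bᵀ = -B) : (cayley B)ᵀ = cayley (-B) := by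
  have h2 := isUnit_one_add_of_skew hB
  have h2' := (isUnit_iff_isUnit_det _).1 h2
  have h3 : (cayley B)ᵀ * (1 + B) = 1 - B := by
    have h := congrArg transpose (one_sub_mul_cayley (isUnit_one_sub_of_skew hB))
    rw [transpose_mul, transpose_sub, transpose_add, hB, transpose_one, sub_neg_eq_add,
      ← sub_eq_add_neg] at h
    exact h
  apply h2.mul_right_cancel
  rw [h3, cayley, sub_neg_eq_add, ← sub_eq_add_neg, mul_assoc,
    (show (1 - B) * (1 + B) = (1 + B) * (1 - B) by noncomm_ring),
    nonsing_inv_mul_cancel_left _ _ h2']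

theorem cayley_mem_orthogonalGroup {B : Matrix ι ι ℝ} (hB : Bᵀ = -B) :
    cayley B ∈ orthogonalGroup ι ℝ := by
  apply mem_orthogonalGroup_of_mul_transpose
  rw [transpose_cayley hB, cayley_mul_cayley_neg hB]

/-- Multiplication by an invertible M is injective on the finite-dimensional algebra A, hence
surjective, and so reaches 1. -/
theorem inv_mem_subalgebra {A : Subalgebra ℝ (Matrix ι ι ℝ)} {M : Matrix ι ι ℝ} (hM : M ∈ A) :
    M⁻¹ ∈ A := by
  by_cases hu : IsUnit M.det
  · have hinj : Function.Injective (LinearMap.mulLeft ℝ (⟨M, hM⟩ : A)) := by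
      intro x y hxy
      have h : M * (x : Matrix ι ι ℝ) = M * y := congrArg Subtype.val hxy
      exact Subtype.ext (((isUnit_iff_isUnit_det _).2 hu).mul_left_cancel h)
    obtain ⟨N, hN⟩ := LinearMap.injective_iff_surjective.1 hinj 1
    have h : M * (N : Matrix ι ι ℝ) = 1 := congrArg Subtype.val hN
    rw [inv_eq_right_inv h]
    exact N.2
  · rw [nonsing_inv_apply_not_isUnit _ hu]
    exact A.zero_mem

theorem cayley_mem_subalgebra {A : Subalgebra ℝ (Matrix ι ι ℝ)} {B : Matrix ι ι ℝ} (hB : B ∈ A) :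
    cayley B ∈ A :=
  A.mul_mem (inv_mem_subalgebra (A.sub_mem A.one_mem hB)) (A.add_mem A.one_mem hB)

/-- The transform is inverted rationally: 1 - B is the inverse of (`cayley B` + 1)/2. -/
theorem mem_subalgebra_of_cayley_mem {A : Subalgebra ℝ (Matrix ι ι ℝ)} {B : Matrix ι ι ℝ}
    (hB : Bᵀ = -B) (h : cayley B ∈ A) : B ∈ A := by
  have hu := isUnit_one_sub_of_skew hB
  have h1 : (1 - B) * (cayley B + 1) = (2 : ℝ) • 1 := by
    rw [mul_add, one_sub_mul_cayley hu, two_smul]; noncomm_ring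
  have h2 : (1 - B) * ((2 : ℝ)⁻¹ • (cayley B + 1)) = 1 := by
    rw [mul_smul_comm, h1, smul_smul]; norm_num
  have h3 : ((2 : ℝ)⁻¹ • (cayley B + 1))⁻¹ = 1 - B := inv_eq_left_inv h2
  have h4 : 1 - B ∈ A := by
    rw [← h3]
    exact inv_mem_subalgebra (A.smul_mem (A.add_mem h A.one_mem) _)
  have h5 := A.sub_mem A.one_mem h4
  rwa [sub_sub_cancel] at h5

theorem Commute.cayley_right {X B : Matrix ι ι ℝ} (h : Commute X B) : Commute X (cayley B) := by
  have hB : B ∈ Subalgebra.centralizer ℝ {X} := by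
    rw [Subalgebra.mem_centralizer_iff]
    rintro _ rfl
    exact h.eq
  exact Subalgebra.mem_centralizer_iff ℝ |>.1 (cayley_mem_subalgebra hB) X rfl

theorem contDiffAt_cayley : ContDiffAt ℝ ω (cayley : Matrix ι ι ℝ → Matrix ι ι ℝ) 0 := by
  have h1 : ContDiffAt ℝ ω (fun B : Matrix ι ι ℝ => 1 - B) 0 := contDiffAt_const.sub contDiffAt_id
  have h2 : ContDiffAt ℝ ω (fun B : Matrix ι ι ℝ => 1 + B) 0 := contDiffAt_const.add contDiffAt_id
  have h3 : ContDiffAt ℝ ω (Ring.inverse : Matrix ι ι ℝ → Matrix ι ι ℝ) (1 - 0) := by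
    have := contDiffAt_ringInverse ℝ (n := ω) (1 : (Matrix ι ι ℝ)ˣ)
    simpa using this
  have h4 := (h3.comp (0 : Matrix ι ι ℝ) h1).mul h2
  refine h4.congr_of_eventuallyEq (Eventually.of_forall fun B => ?_)
  simp [cayley, nonsing_inv_eq_ringInverse]

/-- Differentiating (1 - tB) · cayley(tB) = 1 + tB at 0 gives -B + c' = B, without differentiating
an inverse. -/
theorem hasDerivAt_cayley_smul {B : Matrix ι ι ℝ} (hB : Bᵀ = -B) :
    HasDerivAt (fun t : ℝ => cayley (t • B)) ((2 : ℝ) • B) 0 := by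
  have hd : DifferentiableAt ℝ (fun t : ℝ => cayley (t • B)) 0 := by
    have h0 : DifferentiableAt ℝ (cayley : Matrix ι ι ℝ → Matrix ι ι ℝ) ((0 : ℝ) • B) := by
      rw [zero_smul]
      exact contDiffAt_cayley.differentiableAt (by simp)
    exact h0.comp (0 : ℝ) (differentiableAt_id.smul_const B)
  have h0 : HasDerivAt (fun t : ℝ => t • B) B 0 :=
    ((hasDerivAt_id (0 : ℝ)).smul_const B).congr_deriv (one_smul ℝ B)
  have h1 : HasDerivAt (fun t : ℝ => 1 - t • B) (-B) 0 := h0.const_sub 1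
  have h2 : HasDerivAt (fun t : ℝ => 1 + t • B) B 0 := h0.const_add 1
  have h3 := h1.mul hd.hasDerivAt
  have h4 : ((fun t : ℝ => 1 - t • B) * fun t : ℝ => cayley (t • B)) =
      fun t : ℝ => 1 + t • B := by
    funext t
    exact one_sub_mul_cayley (isUnit_one_sub_of_skew (by rw [transpose_smul, hB, smul_neg]))
  rw [h4] at h3
  have h5 := h3.unique h2
  rw [zero_smul, cayley_zero, mul_one, sub_zero, one_mul] at h5
  have h6 : deriv (fun t : ℝ => cayley (t • B)) 0 = (2 : ℝ) • B := by
    rw [two_smul]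
    exact neg_add_eq_iff_eq_add.1 h5
  rw [← h6]
  exact hd.hasDerivAt

end Cayley

/-! ### A parametrization adapted to orthogonal conjugation -/

section SliceParametrization

variable {ι : Type*} [Fintype ι] [DecidableEq ι]

open Matrix

/-- The space of skew-symmetric matrices. -/
def skewSubmodule (ι : Type*) : Submodule ℝ (Matrix ι ι ℝ) where
  carrier := {Y | Yᵀ = -Y}
  add_mem' {a b} ha hb := by
    simp only [Set.mem_ofPred_eq] at *
    rw [transpose_add, ha, hb, neg_add]
  zero_mem' := by simp
  smul_mem' c a ha := by
    simp only [Set.mem_ofPred_eq] at *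
    rw [transpose_smul, ha, smul_neg]

theorem mem_skewSubmodule {Y : Matrix ι ι ℝ} : Y ∈ skewSubmodule ι ↔ Yᵀ = -Y := Iff.rfl

/-- The skew-symmetric matrices that commute with `X`. -/
def skewCentralizer (X : Matrix ι ι ℝ) : Submodule ℝ (Matrix ι ι ℝ) :=
  skewSubmodule ι ⊓ (Subalgebra.centralizer ℝ {X}).toSubmodule

theorem mem_skewCentralizer {X Y : Matrix ι ι ℝ} :
    Y ∈ skewCentralizer X ↔ Yᵀ = -Y ∧ Commute X Y := by
  simp [skewCentralizer, mem_skewSubmodule, Subalgebra.mem_centralizer_iff, commute_iff_eq]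

/-- The skew-symmetric matrices that are polynomials in `X`. -/
def skewAdjoin (X : Matrix ι ι ℝ) : Submodule ℝ (Matrix ι ι ℝ) :=
  skewSubmodule ι ⊓ (Algebra.adjoin ℝ {X}).toSubmodule

theorem mem_skewAdjoin {X Y : Matrix ι ι ℝ} :
    Y ∈ skewAdjoin X ↔ Yᵀ = -Y ∧ Y ∈ Algebra.adjoin ℝ {X} := by
  simp [skewAdjoin, mem_skewSubmodule]

theorem commute_of_mem_adjoin {X Y : Matrix ι ι ℝ} (h : Y ∈ Algebra.adjoin ℝ {X}) :
    Commute X Y :=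
  Algebra.commute_of_mem_adjoin_self h

theorem skewAdjoin_le_skewCentralizer (X : Matrix ι ι ℝ) : skewAdjoin X ≤ skewCentralizer X :=
  fun _ hY => mem_skewCentralizer.2
    ⟨(mem_skewAdjoin.1 hY).1, commute_of_mem_adjoin (mem_skewAdjoin.1 hY).2⟩

/-- The skew-symmetric part of a matrix. -/
noncomputable def skewPart : Matrix ι ι ℝ →ₗ[ℝ] Matrix ι ι ℝ :=
  (2 : ℝ)⁻¹ • (LinearMap.id - (transposeLinearEquiv ι ι ℝ ℝ).toLinearMap)

/-- The symmetric part of a matrix. -/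
noncomputable def symmPart : Matrix ι ι ℝ →ₗ[ℝ] Matrix ι ι ℝ :=
  (2 : ℝ)⁻¹ • (LinearMap.id + (transposeLinearEquiv ι ι ℝ ℝ).toLinearMap)

theorem skewPart_apply (Y : Matrix ι ι ℝ) : skewPart Y = (2 : ℝ)⁻¹ • (Y - Yᵀ) := rfl

theorem symmPart_apply (Y : Matrix ι ι ℝ) : symmPart Y = (2 : ℝ)⁻¹ • (Y + Yᵀ) := rfl

theorem skewPart_transpose (Y : Matrix ι ι ℝ) : (skewPart Y)ᵀ = -skewPart Y := by
  rw [skewPart_apply, transpose_smul, transpose_sub, transpose_transpose, ← smul_neg, neg_sub]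

theorem symmPart_transpose (Y : Matrix ι ι ℝ) : (symmPart Y)ᵀ = symmPart Y := by
  rw [symmPart_apply, transpose_smul, transpose_add, transpose_transpose, add_comm]

theorem symmPart_add_skewPart (Y : Matrix ι ι ℝ) : symmPart Y + skewPart Y = Y := by
  rw [symmPart_apply, skewPart_apply, ← smul_add, add_add_sub_cancel, ← two_smul ℝ, smul_smul]
  norm_num

theorem symmPart_eq_zero_iff {Y : Matrix ι ι ℝ} : symmPart Y = 0 ↔ Y ∈ skewSubmodule ι := by
  rw [symmPart_apply, smul_eq_zero, mem_skewSubmodule, add_comm, add_eq_zero_iff_eq_neg]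
  norm_num

theorem skewPart_of_mem {Y : Matrix ι ι ℝ} (h : Y ∈ skewSubmodule ι) : skewPart Y = Y := by
  have := symmPart_add_skewPart Y
  rwa [symmPart_eq_zero_iff.2 h, zero_add] at this

/-- A local parametrization of the space of matrices around the orthogonal matrix `X`, adapted to
the conjugation action of the orthogonal group; `g` is a projection to the skew-symmetric matrices
that commute with `X`. -/
noncomputable def sliceParam (X : Matrix ι ι ℝ) (g : Matrix ι ι ℝ →ₗ[ℝ] Matrix ι ι ℝ)
    (Y : Matrix ι ι ℝ) : Matrix ι ι ℝ :=
  cayley (skewPart Y - g (skewPart Y)) * (X * cayley (g (skewPart Y))) * (1 + symmPart Y) *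
    cayley (-(skewPart Y - g (skewPart Y)))

variable {X : Matrix ι ι ℝ} {g : Matrix ι ι ℝ →ₗ[ℝ] Matrix ι ι ℝ}

theorem exists_projection (X : Matrix ι ι ℝ) : ∃ g : Matrix ι ι ℝ →ₗ[ℝ] Matrix ι ι ℝ,
    (∀ Y, g Y ∈ skewCentralizer X) ∧ ∀ Y ∈ skewCentralizer X, g Y = Y := by
  obtain ⟨f, hf⟩ := (skewCentralizer X).subtype.exists_leftInverse_of_injective
    (skewCentralizer X).ker_subtype
  refine ⟨(skewCentralizer X).subtype ∘ₗ f, fun Y => (f Y).2, fun Y hY => ?_⟩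
  have := LinearMap.congr_fun hf ⟨Y, hY⟩
  simpa using congrArg Subtype.val this

theorem sliceParam_zero : sliceParam X g 0 = X := by
  simp [sliceParam, cayley_zero]

theorem contDiffAt_sliceParam : ContDiffAt ℝ ω (sliceParam X g) 0 := by
  have hlin : ∀ f : Matrix ι ι ℝ →ₗ[ℝ] Matrix ι ι ℝ, ContDiffAt ℝ ω f 0 := fun f =>
    (LinearMap.toContinuousLinearMap f).contDiff.contDiffAt
  have hc : ∀ f : Matrix ι ι ℝ → Matrix ι ι ℝ, ContDiffAt ℝ ω f 0 → f 0 = 0 →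
      ContDiffAt ℝ ω (fun Y => cayley (f Y)) 0 := by
    intro f hf h0
    have : ContDiffAt ℝ ω (cayley : Matrix ι ι ℝ → Matrix ι ι ℝ) (f 0) := by
      rw [h0]; exact contDiffAt_cayley
    exact this.comp (0 : Matrix ι ι ℝ) hf
  have hgk : ContDiffAt ℝ ω (fun Y => g (skewPart Y)) 0 := hlin (g ∘ₗ skewPart)
  have ha : ContDiffAt ℝ ω (fun Y => skewPart Y - g (skewPart Y)) 0 := (hlin skewPart).sub hgk
  have h1 := hc _ ha (by simp)
  have h2 := hc _ ha.neg (by simp)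
  have h3 : ContDiffAt ℝ ω (fun Y => X * cayley (g (skewPart Y))) 0 :=
    contDiffAt_const.mul (hc _ hgk (by simp))
  have h4 : ContDiffAt ℝ ω (fun Y : Matrix ι ι ℝ => 1 + symmPart Y) 0 :=
    contDiffAt_const.add (hlin symmPart)
  exact ((h1.mul h3).mul h4).mul h2

/-- The derivative is read off along the line t ↦ tY by the product rule, with every Cayley factor
equal to 1 at t = 0. -/
theorem fderiv_sliceParam (hg : ∀ Y, g Y ∈ skewCentralizer X) (Y : Matrix ι ι ℝ) :
    fderiv ℝ (sliceParam X g) 0 Y =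
      (2 : ℝ) • ((skewPart Y - g (skewPart Y)) * X) + X * ((2 : ℝ) • g (skewPart Y)) +
        X * symmPart Y - (2 : ℝ) • (X * (skewPart Y - g (skewPart Y))) := by
  set b := g (skewPart Y) with hb
  set a := skewPart Y - b with ha
  set s := symmPart Y with hs
  have hbT : bᵀ = -b := (mem_skewCentralizer.1 (hg _)).1
  have haT : aᵀ = -a := by rw [ha, transpose_sub, hbT, skewPart_transpose]; abel
  have hcurve : HasDerivAt (fun t : ℝ => t • Y) Y 0 :=
    ((hasDerivAt_id (0 : ℝ)).smul_const Y).congr_deriv (one_smul ℝ Y)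
  have hF : HasFDerivAt (sliceParam X g) (fderiv ℝ (sliceParam X g) 0) ((0 : ℝ) • Y) := by
    rw [zero_smul]
    exact (contDiffAt_sliceParam.differentiableAt (by simp)).hasFDerivAt
  have h1 := hF.comp_hasDerivAt (0 : ℝ) hcurve
  have h2 := (((hasDerivAt_cayley_smul haT).mul
    ((hasDerivAt_cayley_smul hbT).const_mul X)).mul
    ((((hasDerivAt_id (0 : ℝ)).smul_const s).congr_deriv (one_smul ℝ s)).const_add 1)).mul
    (hasDerivAt_cayley_smul (B := -a) (by rw [transpose_neg, haT]))
  have h3 : (sliceParam X g ∘ fun t : ℝ => t • Y) = (((fun t : ℝ => cayley (t • a)) *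
      fun t : ℝ => X * cayley (t • b)) * fun t : ℝ => 1 + id t • s) *
      fun t : ℝ => cayley (t • (-a)) := by
    funext t
    simp only [sliceParam, Function.comp_apply, map_smul, Pi.mul_apply, id, smul_neg, ha, hb, hs,
      smul_sub]
  rw [h3] at h1
  refine (h1.unique h2).trans ?_
  simp only [Pi.mul_apply, zero_smul, cayley_zero, mul_one, one_mul, id, add_zero, smul_mul_assoc,
    smul_neg, mul_neg, mul_smul_comm, neg_zero]
  abel

/-- Multiplying by Xᵀ turns a kernel equation into s = 2(a - Xᵀ a X - b) with s symmetric and the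
right side skew, so both vanish. Then b = a - Xᵀ a X, while b is fixed by conjugation by X and hence
trace-orthogonal to all such differences; so b = 0. Now a commutes with X, where g is the identity,
yet g a = 0. -/
theorem fderiv_sliceParam_injective (hX : X ∈ orthogonalGroup ι ℝ)
    (hg : ∀ Y, g Y ∈ skewCentralizer X) (hg' : ∀ Y ∈ skewCentralizer X, g Y = Y) :
    Function.Injective (fderiv ℝ (sliceParam X g) 0) := by
  rw [injective_iff_map_eq_zero]
  intro Y hY
  rw [fderiv_sliceParam hg] at hY
  have hXT := transpose_mul_of_mem_orthogonalGroup hX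
  have hXT' := mul_transpose_of_mem_orthogonalGroup hX
  obtain ⟨hbT, hbX⟩ := mem_skewCentralizer.1 (hg (skewPart Y))
  set b := g (skewPart Y) with hb
  set a := skewPart Y - b with ha
  set s := symmPart Y with hs
  have hsT : sᵀ = s := symmPart_transpose Y
  have haT : aᵀ = -a := by rw [ha, transpose_sub, hbT, skewPart_transpose]; abel
  have h1 : s = (2 : ℝ) • (a - Xᵀ * a * X - b) := by
    have h := congrArg (Xᵀ * ·) hY
    simp only [mul_sub, mul_add, mul_smul_comm, ← mul_assoc, hXT, one_mul, mul_zero] at h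
    rw [smul_sub, smul_sub]
    have h' : s - ((2 : ℝ) • a - (2 : ℝ) • (Xᵀ * a * X) - (2 : ℝ) • b) = 0 := by
      rw [← h]; abel
    exact sub_eq_zero.1 h'
  have hskew : (a - Xᵀ * a * X - b)ᵀ = -(a - Xᵀ * a * X - b) := by
    simp only [transpose_sub, transpose_mul, transpose_transpose, haT, hbT, neg_mul, mul_neg,
      mul_assoc]
    abel
  have hs0 : s = 0 := by
    have h : s = -s := by
      conv_lhs => rw [← hsT, h1, transpose_smul, hskew, smul_neg, ← h1]
    have h' : (2 : ℝ) • s = 0 := by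
      rw [two_smul]; exact add_eq_zero_iff_eq_neg.2 h
    exact (smul_eq_zero.1 h').resolve_left (by norm_num)
  have h2 : b = a - Xᵀ * a * X := by
    rw [hs0] at h1
    have := (smul_eq_zero.1 h1.symm).resolve_left (by norm_num)
    exact (sub_eq_zero.1 this).symm
  have hb0 : b = 0 := by
    have hconj : X * b * Xᵀ = b := by rw [hbX.eq, mul_assoc, hXT', mul_one]
    have ht : trace (b * b) = 0 := by
      have e1 : trace (b * (Xᵀ * a * X)) = trace (b * a) := by
        rw [trace_mul_comm, mul_assoc, trace_mul_comm, ← mul_assoc, trace_mul_comm] at *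
        have : trace (b * a) = trace (X * b * Xᵀ * a) := by rw [hconj]
        rw [this, mul_assoc, mul_assoc, trace_mul_comm]
        congr 1
        simp only [mul_assoc]
      have e2 : trace (b * b) = trace (b * (a - Xᵀ * a * X)) := by rw [← h2]
      rw [e2, mul_sub, trace_sub, e1, sub_self]
    have ht' : trace (bᴴ * b) = 0 := by
      rw [conjTranspose_eq_transpose_of_trivial, hbT, neg_mul, trace_neg, ht, neg_zero]
    exact trace_conjTranspose_mul_self_eq_zero_iff.1 ht'
  have haC : a ∈ skewCentralizer X := by
    refine mem_skewCentralizer.2 ⟨haT, ?_⟩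
    rw [hb0] at h2
    have h3 : a = Xᵀ * a * X := sub_eq_zero.1 h2.symm
    calc X * a = X * (Xᵀ * a * X) := by rw [← h3]
      _ = a * X := by rw [← mul_assoc, ← mul_assoc, hXT', one_mul]
  have ha0 : a = 0 := by
    rw [← hg' a haC]
    conv_lhs => rw [ha, map_sub, ← hb, hg' b (hg _), sub_self]
  rw [← symmPart_add_skewPart Y, ← hs, hs0, zero_add]
  have : skewPart Y = a + b := by rw [ha]; abel
  rw [this, ha0, hb0, add_zero]

/-- The derivative at `0` of the parametrization, as an equivalence. -/
theorem exists_equiv_hasFDerivAt_sliceParam (hX : X ∈ orthogonalGroup ι ℝ)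
    (hg : ∀ Y, g Y ∈ skewCentralizer X) (hg' : ∀ Y ∈ skewCentralizer X, g Y = Y) :
    ∃ L : Matrix ι ι ℝ ≃L[ℝ] Matrix ι ι ℝ,
      HasFDerivAt (sliceParam X g) (L : Matrix ι ι ℝ →L[ℝ] Matrix ι ι ℝ) 0 := by
  let L := (LinearEquiv.ofInjectiveEndo (fderiv ℝ (sliceParam X g) 0).toLinearMap
    (fderiv_sliceParam_injective hX hg hg')).toContinuousLinearEquiv
  refine ⟨L, ?_⟩
  have h : (L : Matrix ι ι ℝ →L[ℝ] Matrix ι ι ℝ) = fderiv ℝ (sliceParam X g) 0 := by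
    ext1 Y; rfl
  rw [h]
  exact (contDiffAt_sliceParam.differentiableAt (by simp)).hasFDerivAt

end SliceParametrization

/-! ### Strata and their linear slices -/

section Strata

variable {ι : Type*} [Fintype ι] [DecidableEq ι]

open Matrix

/-- The codimension of the space of skew-symmetric polynomials in `X` in the space of
skew-symmetric matrices that commute with `X`. -/
noncomputable def skewCodim (X : Matrix ι ι ℝ) : ℕ :=
  Module.finrank ℝ (skewCentralizer X) - Module.finrank ℝ (skewAdjoin X)

theorem skewCodim_add_finrank (X : Matrix ι ι ℝ) :
    skewCodim X + Module.finrank ℝ (skewAdjoin X) = Module.finrank ℝ (skewCentralizer X) :=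
  Nat.sub_add_cancel (Submodule.finrank_mono (skewAdjoin_le_skewCentralizer X))

theorem skewCodim_le (X : Matrix ι ι ℝ) :
    skewCodim X ≤ Module.finrank ℝ (skewSubmodule ι) :=
  (Nat.sub_le _ _).trans (Submodule.finrank_mono inf_le_left)

/-- The dimension of the algebra generated by a matrix. -/
noncomputable def adjoinRank (X : Matrix ι ι ℝ) : ℕ :=
  Module.finrank ℝ (Subalgebra.toSubmodule (Algebra.adjoin ℝ {X}))

theorem skewCentralizer_le_of_mem_adjoin {X Y : Matrix ι ι ℝ} (h : X ∈ Algebra.adjoin ℝ {Y}) :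
    skewCentralizer Y ≤ skewCentralizer X := by
  intro B hB
  rw [mem_skewCentralizer] at hB ⊢
  refine ⟨hB.1, ?_⟩
  have hle : Algebra.adjoin ℝ {Y} ≤ Subalgebra.centralizer ℝ {B} := by
    rw [Algebra.adjoin_le_iff, Set.singleton_subset_iff]
    exact (Subalgebra.mem_centralizer_iff ℝ).2 (by rintro _ rfl; exact hB.2.eq.symm)
  exact ((Subalgebra.mem_centralizer_iff ℝ).1 (hle h) B rfl).symm

theorem skewCodim_congr {X Y : Matrix ι ι ℝ}
    (h : Algebra.adjoin ℝ {X} = Algebra.adjoin ℝ {Y}) : skewCodim X = skewCodim Y := by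
  have h1 : skewAdjoin X = skewAdjoin Y := by rw [skewAdjoin, skewAdjoin, h]
  have h2 : skewCentralizer X = skewCentralizer Y := le_antisymm
    (skewCentralizer_le_of_mem_adjoin (h ▸ Algebra.self_mem_adjoin_singleton ℝ Y))
    (skewCentralizer_le_of_mem_adjoin (h ▸ Algebra.self_mem_adjoin_singleton ℝ X))
  rw [skewCodim, skewCodim, h1, h2]

theorem adjoinRank_congr {X Y : Matrix ι ι ℝ}
    (h : Algebra.adjoin ℝ {X} = Algebra.adjoin ℝ {Y}) : adjoinRank X = adjoinRank Y := by
  rw [adjoinRank, adjoinRank, h]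

/-- Conjugation by an orthogonal matrix. -/
noncomputable def conjEquiv {U : Matrix ι ι ℝ} (hU : U ∈ orthogonalGroup ι ℝ) :
    Matrix ι ι ℝ ≃ₐ[ℝ] Matrix ι ι ℝ :=
  AlgEquiv.ofAlgHom
    (AlgHom.ofLinearMap (LinearMap.mulLeftRight ℝ (U, Uᵀ))
      (by simp [mul_transpose_of_mem_orthogonalGroup hU])
      (fun x y => by
        simp only [LinearMap.mulLeftRight_apply]
        calc U * (x * y) * Uᵀ = U * x * 1 * y * Uᵀ := by simp only [mul_one, mul_assoc]
          _ = _ := by rw [← transpose_mul_of_mem_orthogonalGroup hU]; simp only [mul_assoc]))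
    (AlgHom.ofLinearMap (LinearMap.mulLeftRight ℝ (Uᵀ, U))
      (by simp [transpose_mul_of_mem_orthogonalGroup hU])
      (fun x y => by
        simp only [LinearMap.mulLeftRight_apply]
        calc Uᵀ * (x * y) * U = Uᵀ * x * 1 * y * U := by simp only [mul_one, mul_assoc]
          _ = _ := by rw [← mul_transpose_of_mem_orthogonalGroup hU]; simp only [mul_assoc]))
    (by
      ext1 x
      simp only [AlgHom.comp_apply, AlgHom.ofLinearMap_apply, LinearMap.mulLeftRight_apply,
        AlgHom.id_apply]
      calc U * (Uᵀ * x * U) * Uᵀ = (U * Uᵀ) * x * (U * Uᵀ) := by simp only [mul_assoc]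
        _ = x := by rw [mul_transpose_of_mem_orthogonalGroup hU, one_mul, mul_one])
    (by
      ext1 x
      simp only [AlgHom.comp_apply, AlgHom.ofLinearMap_apply, LinearMap.mulLeftRight_apply,
        AlgHom.id_apply]
      calc Uᵀ * (U * x * Uᵀ) * U = (Uᵀ * U) * x * (Uᵀ * U) := by simp only [mul_assoc]
        _ = x := by rw [transpose_mul_of_mem_orthogonalGroup hU, one_mul, mul_one])

theorem conjEquiv_apply {U : Matrix ι ι ℝ} (hU : U ∈ orthogonalGroup ι ℝ) (Y : Matrix ι ι ℝ) :
    conjEquiv hU Y = U * Y * Uᵀ := rfl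

theorem conjEquiv_transpose {U : Matrix ι ι ℝ} (hU : U ∈ orthogonalGroup ι ℝ)
    (Y : Matrix ι ι ℝ) : (conjEquiv hU Y)ᵀ = conjEquiv hU Yᵀ := by
  simp only [conjEquiv_apply, transpose_mul, transpose_transpose, mul_assoc]

section Transport

variable {κ : Type*} [Fintype κ] [DecidableEq κ] (Φ : Matrix ι ι ℝ ≃ₐ[ℝ] Matrix κ κ ℝ)
  (X : Matrix ι ι ℝ)

theorem algEquiv_mem_skewSubmodule_iff (hΦ : ∀ Y, (Φ Y)ᵀ = Φ Yᵀ) (Y : Matrix ι ι ℝ) :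
    Φ Y ∈ skewSubmodule κ ↔ Y ∈ skewSubmodule ι := by
  rw [mem_skewSubmodule, mem_skewSubmodule, hΦ, ← map_neg,
    Φ.injective.eq_iff]

theorem adjoin_algEquiv : Algebra.adjoin ℝ {Φ X} =
    (Algebra.adjoin ℝ {X}).map Φ.toAlgHom := by
  rw [AlgHom.map_adjoin]
  simp

theorem algEquiv_mem_adjoin_iff (Y : Matrix ι ι ℝ) :
    Φ Y ∈ Algebra.adjoin ℝ {Φ X} ↔ Y ∈ Algebra.adjoin ℝ {X} := by
  rw [adjoin_algEquiv, Subalgebra.mem_map]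
  constructor
  · rintro ⟨Z, hZ, h⟩
    rwa [← Φ.injective h]
  · exact fun h => ⟨Y, h, rfl⟩

theorem skewAdjoin_algEquiv (hΦ : ∀ Y, (Φ Y)ᵀ = Φ Yᵀ) :
    skewAdjoin (Φ X) =
    (skewAdjoin X).map Φ.toLinearEquiv.toLinearMap := by
  ext Y
  obtain ⟨Y, rfl⟩ := Φ.surjective Y
  rw [Submodule.mem_map]
  have key : Φ Y ∈ skewAdjoin (Φ X) ↔ Y ∈ skewAdjoin X := by
    rw [mem_skewAdjoin, mem_skewAdjoin, algEquiv_mem_adjoin_iff, ← mem_skewSubmodule,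
      algEquiv_mem_skewSubmodule_iff Φ hΦ, mem_skewSubmodule]
  rw [key]
  constructor
  · exact fun h => ⟨Y, h, rfl⟩
  · rintro ⟨Z, hZ, h⟩
    rwa [← Φ.injective h]

theorem skewCentralizer_algEquiv (hΦ : ∀ Y, (Φ Y)ᵀ = Φ Yᵀ) :
    skewCentralizer (Φ X) =
    (skewCentralizer X).map Φ.toLinearEquiv.toLinearMap := by
  ext Y
  obtain ⟨Y, rfl⟩ := Φ.surjective Y
  rw [Submodule.mem_map]
  have key : Φ Y ∈ skewCentralizer (Φ X) ↔ Y ∈ skewCentralizer X := by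
    rw [mem_skewCentralizer, mem_skewCentralizer, ← mem_skewSubmodule,
      algEquiv_mem_skewSubmodule_iff Φ hΦ, mem_skewSubmodule, commute_iff_eq, commute_iff_eq,
      ← map_mul, ← map_mul, Φ.injective.eq_iff]
  rw [key]
  constructor
  · exact fun h => ⟨Y, h, rfl⟩
  · rintro ⟨Z, hZ, h⟩
    rwa [← Φ.injective h]

/-- Any transpose-preserving algebra isomorphism is allowed, to cover both orthogonal conjugation
and reindexing. -/
theorem skewCodim_algEquiv (hΦ : ∀ Y, (Φ Y)ᵀ = Φ Yᵀ) :
    skewCodim (Φ X) = skewCodim X := by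
  rw [skewCodim, skewCodim, skewAdjoin_algEquiv Φ X hΦ, skewCentralizer_algEquiv Φ X hΦ]
  congr 1
  · exact LinearEquiv.finrank_map_eq Φ.toLinearEquiv _
  · exact LinearEquiv.finrank_map_eq Φ.toLinearEquiv _

theorem adjoinRank_algEquiv : adjoinRank (Φ X) = adjoinRank X := by
  rw [adjoinRank, adjoinRank, adjoin_algEquiv]
  exact LinearEquiv.finrank_map_eq Φ.toLinearEquiv
    (Subalgebra.toSubmodule (Algebra.adjoin ℝ {X}))

end Transport

section Param

variable {X : Matrix ι ι ℝ} {g : Matrix ι ι ℝ →ₗ[ℝ] Matrix ι ι ℝ}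

/-- For every W inside the skew centralizer, the projection g splits its preimage in the skew
matrices as W ⊕ ker g. Comparing the skew part of ℝ[X] with the whole centralizer cancels the
kernel. -/
theorem finrank_slice (hg : ∀ Y, g Y ∈ skewCentralizer X)
    (hg' : ∀ Y ∈ skewCentralizer X, g Y = Y) :
    Module.finrank ℝ ↥(skewSubmodule ι ⊓ (skewAdjoin X).comap g) + skewCodim X =
      Module.finrank ℝ (skewSubmodule ι) := by
  have key : ∀ W ≤ skewCentralizer X, Module.finrank ℝ ↥(skewSubmodule ι ⊓ W.comap g) =
      Module.finrank ℝ W + Module.finrank ℝ ↥(skewSubmodule ι ⊓ LinearMap.ker g) := by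
    intro W hW
    have hsup : W ⊔ (skewSubmodule ι ⊓ LinearMap.ker g) = skewSubmodule ι ⊓ W.comap g := by
      apply le_antisymm
      · refine sup_le (fun Y hY => ⟨(hW hY).1, ?_⟩) (fun Y hY => ⟨hY.1, ?_⟩)
        · rw [SetLike.mem_coe, Submodule.mem_comap, hg' Y (hW hY)]; exact hY
        · have h0 : g Y = 0 := hY.2
          rw [SetLike.mem_coe, Submodule.mem_comap, h0]; exact W.zero_mem
      · rintro Y ⟨hY1, hY2⟩
        rw [SetLike.mem_coe, Submodule.mem_comap] at hY2
        refine Submodule.mem_sup.2 ⟨g Y, hY2, Y - g Y, ⟨?_, ?_⟩, by abel⟩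
        · exact Submodule.sub_mem _ hY1 (hg Y).1
        · rw [SetLike.mem_coe, LinearMap.mem_ker, map_sub, hg' _ (hg Y), sub_self]
    have hinf : W ⊓ (skewSubmodule ι ⊓ LinearMap.ker g) = ⊥ := by
      rw [Submodule.eq_bot_iff]
      rintro Y ⟨hY1, hY2⟩
      have h0 : g Y = 0 := hY2.2
      rw [← hg' Y (hW hY1), h0]
    have := Submodule.finrank_sup_add_finrank_inf_eq W (skewSubmodule ι ⊓ LinearMap.ker g)
    rwa [hsup, hinf, finrank_bot, add_zero] at this
  have h1 := key _ (skewAdjoin_le_skewCentralizer X)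
  have h2 := key _ le_rfl
  have h3 : skewSubmodule ι ⊓ (skewCentralizer X).comap g = skewSubmodule ι :=
    inf_eq_left.2 fun Y _ => hg Y
  rw [h3] at h2
  have := skewCodim_add_finrank X
  omega

theorem tendsto_sliceParam : Tendsto (sliceParam X g) (𝓝 0) (𝓝 X) := by
  have := (contDiffAt_sliceParam (X := X) (g := g)).continuousAt.tendsto
  rwa [sliceParam_zero] at this

theorem sliceParam_eq_conj (hg : ∀ Y, g Y ∈ skewCentralizer X)
    (Y : Matrix ι ι ℝ) : ∃ U ∈ orthogonalGroup ι ℝ,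
      sliceParam X g Y = U * (X * cayley (g (skewPart Y)) * (1 + symmPart Y)) * Uᵀ := by
  have haT : (skewPart Y - g (skewPart Y))ᵀ = -(skewPart Y - g (skewPart Y)) := by
    rw [transpose_sub, (mem_skewCentralizer.1 (hg _)).1, skewPart_transpose]; abel
  refine ⟨_, cayley_mem_orthogonalGroup haT, ?_⟩
  rw [transpose_cayley haT, sliceParam]
  simp only [mul_assoc]

/-- All factors but 1 + s, with s the symmetric part, are orthogonal. If 1 + s is orthogonal then (1
+ s)² = 1, so s(1 + s/2) = 0, and 1 + s/2 is invertible for small s. -/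
theorem eventually_sliceParam_mem_orthogonalGroup_iff (hX : X ∈ orthogonalGroup ι ℝ)
    (hg : ∀ Y, g Y ∈ skewCentralizer X) :
    ∀ᶠ Y in 𝓝 0, sliceParam X g Y ∈ orthogonalGroup ι ℝ ↔ Y ∈ skewSubmodule ι := by
  have hs : Tendsto (fun Y : Matrix ι ι ℝ => (2 : ℝ)⁻¹ • symmPart Y) (𝓝 0) (𝓝 0) := by
    have : Continuous fun Y : Matrix ι ι ℝ => (2 : ℝ)⁻¹ • symmPart Y :=
      (LinearMap.toContinuousLinearMap ((2 : ℝ)⁻¹ • symmPart :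
        Matrix ι ι ℝ →ₗ[ℝ] Matrix ι ι ℝ)).continuous
    simpa using this.tendsto 0
  have hsmall : ∀ᶠ Y in 𝓝 0, ‖-((2 : ℝ)⁻¹ • symmPart (ι := ι) Y)‖ < 1 := by
    have := hs.norm.eventually (gt_mem_nhds (show ‖(0 : Matrix ι ι ℝ)‖ < 1 by simp))
    simpa only [norm_neg] using this
  filter_upwards [hsmall] with Y hY
  obtain ⟨U, hU, hUeq⟩ := sliceParam_eq_conj hg Y
  have hW : X * cayley (g (skewPart Y)) ∈ orthogonalGroup ι ℝ :=
    mul_mem hX (cayley_mem_orthogonalGroup (mem_skewCentralizer.1 (hg _)).1)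
  have hT : ∀ {A : Matrix ι ι ℝ}, A ∈ orthogonalGroup ι ℝ → Aᵀ ∈ orthogonalGroup ι ℝ := by
    intro A hA
    apply mem_orthogonalGroup_of_mul_transpose
    rw [transpose_transpose, transpose_mul_of_mem_orthogonalGroup hA]
  rw [← symmPart_eq_zero_iff, hUeq]
  set W := X * cayley (g (skewPart Y)) with hWdef
  constructor
  · intro h
    have h1 : 1 + symmPart Y ∈ orthogonalGroup ι ℝ := by
      have h2 : 1 + symmPart Y = Wᵀ * (Uᵀ * (U * (W * (1 + symmPart Y)) * Uᵀ) * U) := by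
        have e1 := transpose_mul_of_mem_orthogonalGroup hU
        have e2 := transpose_mul_of_mem_orthogonalGroup hW
        calc 1 + symmPart Y = (Wᵀ * W) * (1 + symmPart Y) := by rw [e2, one_mul]
          _ = Wᵀ * ((Uᵀ * U) * (W * (1 + symmPart Y)) * (Uᵀ * U)) := by
            rw [e1, one_mul, mul_one, mul_assoc]
          _ = _ := by simp only [mul_assoc]
      rw [h2]
      exact mul_mem (hT hW) (mul_mem (mul_mem (hT hU) h) hU)
    have h3 := mul_transpose_of_mem_orthogonalGroup h1
    rw [transpose_add, transpose_one, symmPart_transpose] at h3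
    have hu : IsUnit (1 - -((2 : ℝ)⁻¹ • symmPart Y)) := isUnit_one_sub_of_norm_lt_one hY
    rw [sub_neg_eq_add] at hu
    have h4 : (2 : ℝ) • (symmPart Y * (1 + (2 : ℝ)⁻¹ • symmPart Y)) = 0 := by
      have : (1 + symmPart Y) * (1 + symmPart Y) - 1 =
          (2 : ℝ) • (symmPart Y * (1 + (2 : ℝ)⁻¹ • symmPart Y)) := by
        simp only [mul_add, add_mul, mul_one, one_mul, smul_add, mul_smul_comm, smul_smul]
        norm_num [two_smul]
        abel
      rw [← this, h3, sub_self]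
    have h5 := (smul_eq_zero.1 h4).resolve_left (by norm_num)
    exact hu.mul_left_eq_zero.1 h5
  · intro h
    rw [h, add_zero, mul_one]
    exact mul_mem (mul_mem hU hW) (hT hU)

/-- Near an orthogonal matrix, its stratum is a linear slice. The predicate `P` singles out a part
of the stratum. -/
theorem eventually_sliceParam_mem_stratum_iff (hX : X ∈ orthogonalGroup ι ℝ)
    (hg : ∀ Y, g Y ∈ skewCentralizer X) {P : Matrix ι ι ℝ → Prop}
    (hconj : ∀ U ∈ orthogonalGroup ι ℝ, ∀ Y, P (U * Y * Uᵀ) ↔ P Y)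
    (hstab : ∃ ε > 0, ∀ Y ∈ orthogonalGroup ι ℝ, Algebra.adjoin ℝ {Y} = Algebra.adjoin ℝ {X} →
      ‖Y - X‖ < ε → P Y) :
    ∀ᶠ Y in 𝓝 0, (sliceParam X g Y ∈ orthogonalGroup ι ℝ ∧ P (sliceParam X g Y) ∧
      adjoinRank (sliceParam X g Y) = adjoinRank X ∧ skewCodim (sliceParam X g Y) = skewCodim X) ↔
      Y ∈ skewSubmodule ι ⊓ (skewAdjoin X).comap g := by
  obtain ⟨ε₁, hε₁, hstab⟩ := hstab
  obtain ⟨ε₂, hε₂, hadj⟩ := exists_forall_commute_mem_adjoin hX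
  have hlim : Tendsto (fun Y => X * cayley (g (skewPart Y))) (𝓝 0) (𝓝 X) := by
    have h1 : Continuous fun Y => g (skewPart Y) :=
      (LinearMap.toContinuousLinearMap (g ∘ₗ skewPart)).continuous
    have h2 : Tendsto (fun Y => g (skewPart Y)) (𝓝 0) (𝓝 0) := by
      simpa using h1.tendsto 0
    have h3 : Tendsto (cayley : Matrix ι ι ℝ → Matrix ι ι ℝ) (𝓝 0) (𝓝 1) := by
      have := (contDiffAt_cayley (ι := ι)).continuousAt.tendsto
      rwa [cayley_zero] at this
    have h4 := (tendsto_const_nhds (x := X)).mul (h3.comp h2)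
    rw [mul_one] at h4
    exact h4
  have hnear : ∀ᶠ Y in 𝓝 0, ‖X * cayley (g (skewPart Y)) - X‖ < min ε₁ ε₂ := by
    have := hlim.eventually (Metric.ball_mem_nhds X (lt_min hε₁ hε₂))
    filter_upwards [this] with Y hY
    rwa [dist_eq_norm] at hY
  filter_upwards [hnear, eventually_sliceParam_mem_orthogonalGroup_iff hX hg] with Y hY hO
  rw [hO, Submodule.mem_inf, Submodule.mem_comap]
  refine and_congr_right fun hYs => ?_
  obtain ⟨U, hU, hUeq⟩ := sliceParam_eq_conj hg Y
  rw [symmPart_eq_zero_iff.2 hYs, add_zero, mul_one] at hUeq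
  rw [skewPart_of_mem hYs] at hY hUeq
  obtain ⟨hbT, hbX⟩ := mem_skewCentralizer.1 (hg Y)
  -- All conditions are conjugation invariant, so the point may be replaced by W, which commutes
  -- with X.
  set W := X * cayley (g Y) with hW
  have hWO : W ∈ orthogonalGroup ι ℝ := mul_mem hX (cayley_mem_orthogonalGroup hbT)
  have hXW : Commute X W := (Commute.refl X).mul_right hbX.cayley_right
  have hmem : X ∈ Algebra.adjoin ℝ {W} := hadj W hWO hXW (hY.trans_le (min_le_right _ _))
  have hle : Algebra.adjoin ℝ {X} ≤ Algebra.adjoin ℝ {W} := by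
    rw [Algebra.adjoin_le_iff, Set.singleton_subset_iff]; exact hmem
  rw [hUeq, hconj U hU, ← conjEquiv_apply hU, adjoinRank_algEquiv,
    skewCodim_algEquiv _ _ (conjEquiv_transpose hU)]
  have hself := Algebra.self_mem_adjoin_singleton ℝ X
  have hXinv : Xᵀ ∈ Algebra.adjoin ℝ {X} := by
    rw [← inv_eq_right_inv (mul_transpose_of_mem_orthogonalGroup hX)]
    exact inv_mem_subalgebra hself
  constructor
  -- The rank alone forces ℝ[W] = ℝ[X]; the conditions on P and `skewCodim` are then automatic.
  · rintro ⟨-, hr, -⟩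
    have heq : Subalgebra.toSubmodule (Algebra.adjoin ℝ {X}) =
        Subalgebra.toSubmodule (Algebra.adjoin ℝ {W}) :=
      Submodule.eq_of_le_of_finrank_eq hle hr.symm
    have heq' : Algebra.adjoin ℝ {X} = Algebra.adjoin ℝ {W} :=
      Subalgebra.toSubmodule_injective heq
    have hWX : W ∈ Algebra.adjoin ℝ {X} := heq' ▸ Algebra.self_mem_adjoin_singleton ℝ W
    have hc : cayley (g Y) ∈ Algebra.adjoin ℝ {X} := by
      have h1 : cayley (g Y) = Xᵀ * W := by
        rw [hW, ← mul_assoc, transpose_mul_of_mem_orthogonalGroup hX, one_mul]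
      rw [h1]
      exact mul_mem hXinv hWX
    exact mem_skewAdjoin.2 ⟨hbT, mem_subalgebra_of_cayley_mem hbT hc⟩
  · intro hb
    have hWX : W ∈ Algebra.adjoin ℝ {X} :=
      mul_mem hself (cayley_mem_subalgebra (mem_skewAdjoin.1 hb).2)
    have heq : Algebra.adjoin ℝ {W} = Algebra.adjoin ℝ {X} := by
      refine le_antisymm ?_ hle
      rw [Algebra.adjoin_le_iff, Set.singleton_subset_iff]; exact hWX
    exact ⟨hstab W hWO heq (hY.trans_le (min_le_left _ _)), adjoinRank_congr heq,
      skewCodim_congr heq⟩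

end Param

end Strata

/-! ### From strata to codimension; persistence of multiple eigenvalues -/

section Codimension

open Matrix

theorem det_eq_one_or_neg_one {ι : Type*} [Fintype ι] [DecidableEq ι] {X : Matrix ι ι ℝ}
    (hX : X ∈ orthogonalGroup ι ℝ) : X.det = 1 ∨ X.det = -1 := by
  have h := congrArg det (mul_transpose_of_mem_orthogonalGroup hX)
  rw [det_mul, det_transpose, det_one] at h
  exact mul_self_eq_one_iff.1 h

variable {n : ℕ} {δ : ℝ}

/-- Orthogonal determinants are ±1, so by continuity the determinant stays equal to δ near X. -/
theorem eventually_det_sliceParam (hδ : δ = 1 ∨ δ = -1) {X : Matrix (Fin n) (Fin n) ℝ}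
    (hX : X.det = δ) (g : Matrix (Fin n) (Fin n) ℝ →ₗ[ℝ] Matrix (Fin n) (Fin n) ℝ) :
    ∀ᶠ Y in 𝓝 0, sliceParam X g Y ∈ orthogonalWithDet n δ ↔
      sliceParam X g Y ∈ orthogonalGroup (Fin n) ℝ := by
  have h1 : Tendsto (fun Y => (sliceParam X g Y).det) (𝓝 0) (𝓝 δ) := by
    rw [← hX]
    exact ((continuous_id.matrix_det).tendsto X).comp tendsto_sliceParam
  filter_upwards [h1.eventually (Metric.ball_mem_nhds δ one_pos)] with Y hY
  refine ⟨fun h => h.1, fun h => ⟨h, ?_⟩⟩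
  rw [Real.dist_eq, abs_lt] at hY
  rcases det_eq_one_or_neg_one h with h | h <;> rcases hδ with rfl | rfl <;> rw [h] at hY ⊢ <;>
    norm_num at hY

theorem isSmoothSubmanifold_orthogonalWithDet (hδ : δ = 1 ∨ δ = -1) :
    IsSmoothSubmanifold (orthogonalWithDet n δ)
      (Module.finrank ℝ (skewSubmodule (Fin n))) := by
  rintro X ⟨hX, hdet⟩
  obtain ⟨g, hg, hg'⟩ := exists_projection X
  obtain ⟨L, hL⟩ := exists_equiv_hasFDerivAt_sliceParam hX hg hg'
  have hev : ∀ᶠ Y in 𝓝 0, sliceParam X g Y ∈ orthogonalWithDet n δ ↔ Y ∈ skewSubmodule (Fin n) := by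
    filter_upwards [eventually_det_sliceParam hδ hdet g,
      eventually_sliceParam_mem_orthogonalGroup_iff hX hg] with Y h1 h2
    rw [h1, h2]
  obtain ⟨φ, h1, h2, h3, h4⟩ := exists_slice_chart contDiffAt_sliceParam hL hev
  rw [sliceParam_zero] at h1
  exact ⟨φ, _, h1, h2, h3, rfl, h4⟩

/-- A conjugation-invariant property of orthogonal matrices that is locally constant along the
strata, and holds only on strata of codimension at least `c`, with equality somewhere, defines a
subset of codimension `c`. -/
theorem hasCodimIn_of_strata (hδ : δ = 1 ∨ δ = -1) {P : Matrix (Fin n) (Fin n) ℝ → Prop} {c : ℕ}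
    (hconj : ∀ U ∈ orthogonalGroup (Fin n) ℝ, ∀ Y, P (U * Y * Uᵀ) ↔ P Y)
    (hstab : ∀ X ∈ orthogonalGroup (Fin n) ℝ, P X → ∃ ε > 0, ∀ Y ∈ orthogonalGroup (Fin n) ℝ,
      Algebra.adjoin ℝ {Y} = Algebra.adjoin ℝ {X} → ‖Y - X‖ < ε → P Y)
    (hlow : ∀ X ∈ orthogonalWithDet n δ, P X → c ≤ skewCodim X)
    (hex : ∃ X ∈ orthogonalWithDet n δ, P X ∧ skewCodim X ≤ c) :
    HasCodimIn {X ∈ orthogonalWithDet n δ | P X} (orthogonalWithDet n δ) c := by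
  set D := Module.finrank ℝ (skewSubmodule (Fin n)) with hD
  set R := Module.finrank ℝ (Matrix (Fin n) (Fin n) ℝ) with hR
  have hrank : ∀ X : Matrix (Fin n) (Fin n) ℝ, adjoinRank X < R + 1 := fun X =>
    Nat.lt_succ_of_le (Submodule.finrank_le _)
  have hcod : ∀ X : Matrix (Fin n) (Fin n) ℝ, skewCodim X < D + 1 := fun X =>
    Nat.lt_succ_of_le (skewCodim_le X)
  obtain ⟨X₀, hX₀, hPX₀, hle⟩ := hex
  have hX₀c : skewCodim X₀ = c := le_antisymm hle (hlow _ hX₀ hPX₀)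
  have hcD : c ≤ D := hX₀c ▸ skewCodim_le X₀
  refine ⟨fun X hX => hX.1, D, isSmoothSubmanifold_orthogonalWithDet hδ,
    Fin (R + 1) × Fin (D + 1), inferInstance,
    fun i => {X | X ∈ orthogonalWithDet n δ ∧ P X ∧ adjoinRank X = i.1 ∧ skewCodim X = i.2},
    -- Pieces with index below c are empty; the maximum only makes their nominal dimension satisfy
    -- the bound.
    fun i => D - max (i.2 : ℕ) c, ?_, ?_, ?_, ?_, ?_⟩
  · ext X
    simp only [Set.mem_iUnion]
    constructor
    · rintro ⟨h1, h2⟩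
      exact ⟨(⟨_, hrank X⟩, ⟨_, hcod X⟩), h1, h2, rfl, rfl⟩
    · rintro ⟨i, h1, h2, -⟩
      exact ⟨h1, h2⟩
  · intro i j hij
    rw [Set.disjoint_left]
    rintro X ⟨-, -, h1, h2⟩ ⟨-, -, h3, h4⟩
    exact hij (Prod.ext (Fin.ext (h1.symm.trans h3)) (Fin.ext (h2.symm.trans h4)))
  · rintro ⟨i, j⟩ X ⟨hXN, hPX, hXi, hXj⟩
    simp only at hXi hXj
    have hcj : c ≤ (j : ℕ) := hXj ▸ hlow X hXN hPX
    obtain ⟨hX, hdet⟩ := hXN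
    obtain ⟨g, hg, hg'⟩ := exists_projection X
    obtain ⟨L, hL⟩ := exists_equiv_hasFDerivAt_sliceParam hX hg hg'
    have hev : ∀ᶠ Y in 𝓝 0, sliceParam X g Y ∈ {X | X ∈ orthogonalWithDet n δ ∧ P X ∧
        adjoinRank X = i ∧ skewCodim X = j} ↔
        Y ∈ skewSubmodule (Fin n) ⊓ (skewAdjoin X).comap g := by
      filter_upwards [eventually_det_sliceParam hδ hdet g,
        eventually_sliceParam_mem_stratum_iff hX hg hconj (hstab X hX hPX)] with Y h1 h2
      rw [← hXi, ← hXj, ← h2, ← h1]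
    obtain ⟨φ, h1, h2, h3, h4⟩ := exists_slice_chart contDiffAt_sliceParam hL hev
    rw [sliceParam_zero] at h1
    refine ⟨φ, _, h1, h2, h3, ?_, h4⟩
    have := finrank_slice hg hg'
    simp only [max_eq_left hcj]
    omega
  · intro i
    have := i.2.2
    have := le_max_right (i.2 : ℕ) c
    have : max (i.2 : ℕ) c ≤ D := max_le (by omega) hcD
    simp only
    omega
  · refine ⟨(⟨_, hrank X₀⟩, ⟨_, hcod X₀⟩), ⟨X₀, hX₀, hPX₀, rfl, rfl⟩, ?_⟩
    simp only [hX₀c, max_self]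
    omega

variable {ι : Type*} [Fintype ι] [DecidableEq ι]

/-- Some complex number with the property `Q` is a multiple eigenvalue of `X`. -/
def HasDoubleEigenvalue (Q : ℂ → Prop) (X : Matrix ι ι ℝ) : Prop :=
  ∃ z : ℂ, Q z ∧ 2 ≤ (cpx X).charpoly.rootMultiplicity z

theorem rootMultiplicity_cpx {X : Matrix ι ι ℝ} (hX : X ∈ orthogonalGroup ι ℝ) (z : ℂ) :
    (cpx X).charpoly.rootMultiplicity z = Module.finrank ℂ (eigenspace (toLin' (cpx X)) z) :=
  (finrank_eigenspace_eq_rootMultiplicity (cpx_commute_conjTranspose hX) z).symm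

theorem hasDoubleEigenvalue_conj {Q : ℂ → Prop} (U : Matrix ι ι ℝ)
    (hU : U ∈ orthogonalGroup ι ℝ) (X : Matrix ι ι ℝ) :
    HasDoubleEigenvalue Q (U * X * Uᵀ) ↔ HasDoubleEigenvalue Q X := by
  have h : (U * X * Uᵀ).charpoly = X.charpoly := by
    let u : (Matrix ι ι ℝ)ˣ := ⟨U, Uᵀ, mul_transpose_of_mem_orthogonalGroup hU,
      transpose_mul_of_mem_orthogonalGroup hU⟩
    have h := charpoly_units_conj u X
    rwa [← coe_units_inv] at h
  rw [HasDoubleEigenvalue, HasDoubleEigenvalue, charpoly_map, charpoly_map, h]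

theorem exists_eigenvector_of_two_le {A : Matrix ι ι ℂ} {z : ℂ}
    (h : 2 ≤ Module.finrank ℂ (eigenspace (toLin' A) z)) : ∃ v, v ≠ 0 ∧ A *ᵥ v = z • v := by
  have : Nontrivial (eigenspace (toLin' A) z) :=
    Module.nontrivial_of_finrank_pos (R := ℂ) (by omega)
  obtain ⟨v, hv⟩ := exists_ne (0 : eigenspace (toLin' A) z)
  refine ⟨v, fun h => hv (Subtype.ext h), ?_⟩
  have := mem_eigenspace_iff.1 v.2
  rwa [toLin'_apply] at this

/-- Multiple eigenvalues persist along the strata; the hypothesis on `Q` says that it depends only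
on realness up to a small perturbation on the unit circle. -/
theorem hasDoubleEigenvalue_stable {Q : ℂ → Prop}
    (hQ : ∀ z w : ℂ, Q z → (z.im = 0 ↔ w.im = 0) →
      (z.im = 0 → (z = 1 ∨ z = -1) ∧ (w = 1 ∨ w = -1)) → ‖w - z‖ < 2 → Q w)
    {X Y : Matrix ι ι ℝ} (hX : X ∈ orthogonalGroup ι ℝ) (hY : Y ∈ orthogonalGroup ι ℝ)
    (hadj : Algebra.adjoin ℝ {Y} = Algebra.adjoin ℝ {X}) (hlt : ‖Y - X‖ < 2)
    (h : HasDoubleEigenvalue Q X) : HasDoubleEigenvalue Q Y := by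
  obtain ⟨z, hz, hm⟩ := h
  rw [rootMultiplicity_cpx hX] at hm
  obtain ⟨p, hp⟩ := exists_polynomial_of_mem_adjoin
    (hadj ▸ Algebra.self_mem_adjoin_singleton ℝ Y : Y ∈ Algebra.adjoin ℝ {X})
  obtain ⟨q, hq⟩ := exists_polynomial_of_mem_adjoin
    (hadj ▸ Algebra.self_mem_adjoin_singleton ℝ X : X ∈ Algebra.adjoin ℝ {Y})
  obtain ⟨v, hv, hvz⟩ := exists_eigenvector_of_two_le hm
  have hvw := hp z v hvz
  set w := Polynomial.aeval z p with hw
  -- The eigenvalues are related by w = p(z) and z = q(w) with real p and q, so one is real iff the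
  -- other is.
  have hreal : ∀ (r : Polynomial ℝ) (x : ℂ), x.im = 0 → (Polynomial.aeval x r).im = 0 := by
    intro r x hx
    have h1 : x = (algebraMap ℝ ℂ) x.re := by apply Complex.ext <;> simp [hx]
    rw [h1, Polynomial.aeval_algebraMap_apply]
    simp
  have hzq : z = Polynomial.aeval w q := by
    have h1 := hq w v hvw
    rw [hvz] at h1
    exact smul_left_injective ℂ hv h1
  have hiff : z.im = 0 ↔ w.im = 0 :=
    ⟨fun h => hreal p z h, fun h => by rw [hzq]; exact hreal q w h⟩
  refine ⟨w, hQ z w hz hiff (fun h => ⟨eigenvalue_eq_one_or_neg_one hX hv hvz h,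
    eigenvalue_eq_one_or_neg_one hY hv hvw (hiff.1 h)⟩)
    ((norm_eigenvalue_sub_le hv hvw hvz).trans_lt hlt), ?_⟩
  rw [rootMultiplicity_cpx hY]
  refine hm.trans (Submodule.finrank_mono fun x hx => ?_)
  rw [mem_eigenspace_iff, toLin'_apply] at hx ⊢
  exact hp z x hx

end Codimension

/-! ### Lower bounds from so(p) and su(2) -/

section LowerBounds

open Matrix
open scoped ComplexOrder

variable {ι : Type*} [Fintype ι] [DecidableEq ι]

/-- The image of f is a subspace of the skew centralizer independent of the skew polynomials in X.
-/
theorem finrank_le_skewCodim {X : Matrix ι ι ℝ} {F : Type*} [AddCommGroup F] [Module ℝ F]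
    [FiniteDimensional ℝ F] (f : F →ₗ[ℝ] Matrix ι ι ℝ) (hf : ∀ t, f t ∈ skewCentralizer X)
    (hf' : ∀ t, f t ∈ skewAdjoin X → t = 0) : Module.finrank ℝ F ≤ skewCodim X := by
  have hinj : Function.Injective f := by
    rw [injective_iff_map_eq_zero]
    exact fun t ht => hf' t (ht ▸ Submodule.zero_mem _)
  have h1 := Submodule.finrank_sup_add_finrank_inf_eq (LinearMap.range f) (skewAdjoin X)
  have h2 : LinearMap.range f ⊓ skewAdjoin X = ⊥ := by
    rw [Submodule.eq_bot_iff]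
    rintro _ ⟨⟨t, rfl⟩, ht⟩
    rw [hf' t ht, map_zero]
  have h3 : LinearMap.range f ⊔ skewAdjoin X ≤ skewCentralizer X :=
    sup_le (by rintro _ ⟨t, rfl⟩; exact hf t) (skewAdjoin_le_skewCentralizer X)
  have h4 := Submodule.finrank_mono h3
  rw [h2, finrank_bot, add_zero, LinearMap.finrank_range_of_inj hinj] at h1
  have := skewCodim_add_finrank X
  omega

/-- Rank–nullity: c linear conditions suffice to cut the skew centralizer down into ℝ[X]. -/
theorem skewCodim_le_of_ker {X : Matrix ι ι ℝ} {c : ℕ} (f : Matrix ι ι ℝ →ₗ[ℝ] (Fin c → ℝ))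
    (hf : ∀ Y, Yᵀ = -Y → Commute X Y → f Y = 0 → Y ∈ Algebra.adjoin ℝ {X}) :
    skewCodim X ≤ c := by
  have h1 := LinearMap.finrank_range_add_finrank_ker (f.domRestrict (skewCentralizer X))
  have h2 : Module.finrank ℝ (LinearMap.range (f.domRestrict (skewCentralizer X))) ≤ c := by
    simpa using Submodule.finrank_le (LinearMap.range (f.domRestrict (skewCentralizer X)))
  have h3 : (LinearMap.ker (f.domRestrict (skewCentralizer X))).map
      (skewCentralizer X).subtype ≤ skewAdjoin X := by
    rintro _ ⟨⟨Y, hY⟩, hY0, rfl⟩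
    obtain ⟨hYT, hYX⟩ := mem_skewCentralizer.1 hY
    exact mem_skewAdjoin.2 ⟨hYT, hf Y hYT hYX hY0⟩
  have h4 := Submodule.finrank_mono h3
  rw [Submodule.finrank_map_subtype_eq] at h4
  have := skewCodim_add_finrank X
  omega

theorem exists_orthonormal_eigenvectors {𝕜 : Type*} [RCLike 𝕜] {A : Matrix ι ι 𝕜} {z : 𝕜} {p : ℕ}
    (h : p ≤ Module.finrank 𝕜 (eigenspace (toLin' A) z)) :
    ∃ W : Matrix ι (Fin p) 𝕜, Wᴴ * W = 1 ∧ A * W = z • W := by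
  let e := (WithLp.linearEquiv 2 𝕜 (ι → 𝕜)).symm
  set S : Submodule 𝕜 (EuclideanSpace 𝕜 ι) := (eigenspace (toLin' A) z).map e.toLinearMap with hS
  have hfin : Module.finrank 𝕜 S = Module.finrank 𝕜 (eigenspace (toLin' A) z) :=
    LinearEquiv.finrank_map_eq e _
  let b := stdOrthonormalBasis 𝕜 S
  let k : Fin p → Fin (Module.finrank 𝕜 S) := Fin.castLE (h.trans hfin.ge)
  have hk : Function.Injective k := Fin.castLE_injective _
  refine ⟨Matrix.of fun i j => (b (k j) : EuclideanSpace 𝕜 ι) i, ?_, ?_⟩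
  · ext i j
    have h1 := orthonormal_iff_ite.1 b.orthonormal (k i) (k j)
    rw [Submodule.coe_inner, PiLp.inner_apply] at h1
    simp only [hk.eq_iff] at h1
    rw [Matrix.mul_apply, Matrix.one_apply, ← h1]
    refine Finset.sum_congr rfl fun x _ => ?_
    simp [conjTranspose_apply, mul_comm]
  · ext i j
    obtain ⟨v, hv, hvb⟩ := (b (k j)).2
    have hv' : A *ᵥ v = z • v := by
      have := mem_eigenspace_iff.1 hv
      rwa [toLin'_apply] at this
    have hcol : ∀ i, (b (k j) : EuclideanSpace 𝕜 ι) i = v i := by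
      intro i; rw [← hvb]; rfl
    have := congrFun hv' i
    simp only [Matrix.mul_apply, of_apply, Matrix.smul_apply, hcol]
    simpa [mulVec, dotProduct] using this

/-- With orthonormal eigenvectors as columns of W, T ↦ W T Wᵀ embeds so(p) in the skew centralizer.
A polynomial in X is scalar on the eigenspace, and a skew scalar matrix is 0. -/
theorem finrank_skewSubmodule_le_skewCodim {X : Matrix ι ι ℝ} (hX : X ∈ orthogonalGroup ι ℝ)
    {z : ℝ} (hz : z = 1 ∨ z = -1) {p : ℕ}
    (h : p ≤ Module.finrank ℝ (eigenspace (toLin' X) z)) :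
    Module.finrank ℝ (skewSubmodule (Fin p)) ≤ skewCodim X := by
  obtain ⟨W, hW, hXW⟩ := exists_orthonormal_eigenvectors h
  rw [conjTranspose_eq_transpose_of_trivial] at hW
  have hzz : z * z = 1 := by rcases hz with rfl | rfl <;> norm_num
  have hXTW : Xᵀ * W = z • W := by
    have h1 : Xᵀ * (X * W) = W := by
      rw [← Matrix.mul_assoc, transpose_mul_of_mem_orthogonalGroup hX, Matrix.one_mul]
    rw [hXW, Matrix.mul_smul] at h1
    calc Xᵀ * W = (z * z) • (Xᵀ * W) := by rw [hzz, one_smul]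
      _ = z • W := by rw [mul_smul, h1]
  let f : skewSubmodule (Fin p) →ₗ[ℝ] Matrix ι ι ℝ :=
    { toFun := fun T => W * (T : Matrix (Fin p) (Fin p) ℝ) * Wᵀ
      map_add' := fun S T => by simp [Matrix.mul_add, Matrix.add_mul]
      map_smul' := fun c T => by simp }
  refine finrank_le_skewCodim f (fun T => ?_) (fun T hT => ?_)
  · have hT := mem_skewSubmodule.1 T.2
    refine mem_skewCentralizer.2 ⟨?_, ?_⟩
    · change (W * (T : Matrix (Fin p) (Fin p) ℝ) * Wᵀ)ᵀ = -(W * (T : Matrix (Fin p) (Fin p) ℝ) * Wᵀ)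
      rw [transpose_mul, transpose_mul, transpose_transpose, hT, Matrix.neg_mul, Matrix.mul_neg,
        Matrix.mul_assoc]
    · change X * (W * (T : Matrix (Fin p) (Fin p) ℝ) * Wᵀ) =
        (W * (T : Matrix (Fin p) (Fin p) ℝ) * Wᵀ) * X
      have h2 : Wᵀ * X = z • Wᵀ := by
        have := congrArg transpose hXTW
        rwa [transpose_mul, transpose_transpose, transpose_smul] at this
      rw [Matrix.mul_assoc (W * _), h2, Matrix.mul_smul, ← Matrix.mul_assoc, ← Matrix.mul_assoc,
        hXW, Matrix.smul_mul, Matrix.smul_mul]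
  · obtain ⟨-, hadj⟩ := mem_skewAdjoin.1 hT
    rw [Algebra.adjoin_singleton_eq_range_aeval] at hadj
    obtain ⟨q, hq⟩ := hadj
    change Polynomial.aeval X q = W * (T : Matrix (Fin p) (Fin p) ℝ) * Wᵀ at hq
    have hqW : Polynomial.aeval X q * W = q.eval z • W := by
      ext i j
      have hcol : X *ᵥ (fun i => W i j) = z • fun i => W i j := by
        funext i
        have := congrFun (congrFun hXW i) j
        simpa [Matrix.mul_apply, mulVec, dotProduct] using this
      have := congrFun (aeval_mulVec_of_eigenvector hcol q) i
      simpa [Matrix.mul_apply, mulVec, dotProduct] using this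
    have hT' : (T : Matrix (Fin p) (Fin p) ℝ) = q.eval z • 1 := by
      have h1 : Wᵀ * (Polynomial.aeval X q * W) = T := by
        rw [hq, Matrix.mul_assoc, Matrix.mul_assoc, hW, Matrix.mul_one,
          ← Matrix.mul_assoc, hW, Matrix.one_mul]
      rw [← h1, hqW, Matrix.mul_smul, hW]
    have hTT := mem_skewSubmodule.1 T.2
    rw [hT', transpose_smul, transpose_one] at hTT
    have h0 : (T : Matrix (Fin p) (Fin p) ℝ) = 0 := by
      rw [hT']
      have : (2 : ℝ) • (q.eval z • (1 : Matrix (Fin p) (Fin p) ℝ)) = 0 := by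
        rw [two_smul]; exact add_eq_zero_iff_eq_neg.2 hTT
      exact (smul_eq_zero.1 this).resolve_left (by norm_num)
    exact Subtype.ext h0

theorem one_le_finrank_skewSubmodule : 1 ≤ Module.finrank ℝ (skewSubmodule (Fin 2)) := by
  have hmem : !![0, 1; -1, 0] ∈ skewSubmodule (Fin 2) := by
    rw [mem_skewSubmodule]
    ext i j; fin_cases i <;> fin_cases j <;> simp
  have : Nontrivial (skewSubmodule (Fin 2)) :=
    ⟨⟨⟨_, hmem⟩, 0, fun h => by
      have := congrFun (congrFun (congrArg Subtype.val h) 0) 1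
      simp at this⟩⟩
  exact Module.finrank_pos

/-- The skew-symmetric matrices of size three. -/
def skewParam : (Fin 3 → ℝ) →ₗ[ℝ] Matrix (Fin 3) (Fin 3) ℝ where
  toFun t := !![0, t 0, t 1; -t 0, 0, t 2; -t 1, -t 2, 0]
  map_add' s t := by
    ext i j; fin_cases i <;> fin_cases j <;> simp <;> ring
  map_smul' c t := by
    ext i j; fin_cases i <;> fin_cases j <;> simp

theorem skewParam_apply (t : Fin 3 → ℝ) :
    skewParam t = !![0, t 0, t 1; -t 0, 0, t 2; -t 1, -t 2, 0] := rfl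

theorem three_le_finrank_skewSubmodule : 3 ≤ Module.finrank ℝ (skewSubmodule (Fin 3)) := by
  have hmem : LinearMap.range skewParam ≤ skewSubmodule (Fin 3) := by
    rintro _ ⟨t, rfl⟩
    rw [mem_skewSubmodule, skewParam_apply]
    ext i j; fin_cases i <;> fin_cases j <;> simp
  have hinj : Function.Injective skewParam := by
    rw [injective_iff_map_eq_zero]
    intro t ht
    rw [skewParam_apply] at ht
    funext i
    fin_cases i
    · simpa using congrFun (congrFun ht 0) 1
    · simpa using congrFun (congrFun ht 0) 2
    · simpa using congrFun (congrFun ht 1) 2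
  have := Submodule.finrank_mono hmem
  rw [LinearMap.finrank_range_of_inj hinj] at this
  simpa using this

/-- The trace-free skew-Hermitian matrices of size two. -/
noncomputable def specialUnitaryParam : (Fin 3 → ℝ) →ₗ[ℝ] Matrix (Fin 2) (Fin 2) ℂ where
  toFun t := !![t 0 * Complex.I, t 1 + t 2 * Complex.I; -t 1 + t 2 * Complex.I, -t 0 * Complex.I]
  map_add' s t := by
    ext i j; fin_cases i <;> fin_cases j <;> simp <;> ring
  map_smul' c t := by
    ext i j; fin_cases i <;> fin_cases j <;> simp <;> ring

theorem specialUnitaryParam_apply (t : Fin 3 → ℝ) : specialUnitaryParam t =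
    !![t 0 * Complex.I, t 1 + t 2 * Complex.I; -t 1 + t 2 * Complex.I, -t 0 * Complex.I] := rfl

theorem specialUnitaryParam_conjTranspose (t : Fin 3 → ℝ) :
    (specialUnitaryParam t)ᴴ = -specialUnitaryParam t := by
  rw [specialUnitaryParam_apply]
  ext i j; fin_cases i <;> fin_cases j <;> simp [add_comm]

theorem eq_zero_of_specialUnitaryParam_eq {t : Fin 3 → ℝ} {a : ℂ}
    (h : specialUnitaryParam t = a • 1) : t = 0 := by
  rw [specialUnitaryParam_apply] at h
  have h00 := congrFun (congrFun h 0) 0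
  have h01 := congrFun (congrFun h 0) 1
  have h11 := congrFun (congrFun h 1) 1
  simp at h00 h01 h11
  have e0 := congrArg Complex.im (h00.trans h11.symm)
  have e1 := congrArg Complex.re h01
  have e2 := congrArg Complex.im h01
  simp at e0 e1 e2
  funext i
  fin_cases i
  · simp; linarith
  · simpa using e1
  · simpa using e2

/-- The entrywise real part of a complex matrix. -/
noncomputable def matrixRe : Matrix ι ι ℂ →ₗ[ℝ] Matrix ι ι ℝ where
  toFun M := M.map Complex.re
  map_add' M N := by ext; simp
  map_smul' c M := by ext; simp

theorem matrixRe_apply (M : Matrix ι ι ℂ) (i j : ι) : matrixRe M i j = (M i j).re := rfl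

theorem cpx_matrixRe (M : Matrix ι ι ℂ) :
    (2 : ℂ) • cpx (matrixRe M) = M + M.map (starRingEnd ℂ) := by
  ext i j
  simp only [Matrix.smul_apply, Matrix.add_apply, map_apply, matrixRe_apply]
  rw [Complex.add_conj]
  simp

/-- Two orthonormal eigenvectors W embed su(2) by S ↦ Re(W S Wᴴ). If the image is a polynomial in X,
it is scalar on W, which makes S scalar; being trace-free, S = 0. -/
theorem three_le_skewCodim_of_nonreal {X : Matrix ι ι ℝ} (hX : X ∈ orthogonalGroup ι ℝ)
    {z : ℂ} (hz : z.im ≠ 0) (h : 2 ≤ Module.finrank ℂ (eigenspace (toLin' (cpx X)) z)) :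
    3 ≤ skewCodim X := by
  obtain ⟨v, hv, hvz⟩ := exists_eigenvector_of_two_le h
  have hnorm := norm_eigenvalue_eq_one hX hv hvz
  obtain ⟨W, hW, hXW⟩ := exists_orthonormal_eigenvectors h
  have hzz : star z * z = 1 := by
    have := Complex.conj_mul' z
    rw [hnorm] at this
    simpa using this
  have hXHW : (cpx X)ᴴ * W = star z • W := by
    have h1 : (cpx X)ᴴ * (cpx X * W) = W := by
      rw [← Matrix.mul_assoc, cpx_conjTranspose_mul_self hX, Matrix.one_mul]
    rw [hXW, Matrix.mul_smul] at h1
    calc (cpx X)ᴴ * W = (star z * z) • ((cpx X)ᴴ * W) := by rw [hzz, one_smul]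
      _ = star z • W := by rw [mul_smul, h1]
  have hWX : Wᴴ * cpx X = z • Wᴴ := by
    have := congrArg conjTranspose hXHW
    rwa [conjTranspose_mul, conjTranspose_conjTranspose, conjTranspose_smul, star_star] at this
  -- X preserves the bilinear form and z² ≠ 1, so the z-eigenspace is isotropic. Hence the conjugate
  -- of M kills W.
  have hWW : Wᵀ * W = 0 := by
    have h1 : (cpx X * W)ᵀ * (cpx X * W) = Wᵀ * W := by
      have h2 : (cpx X)ᵀ * cpx X = 1 := by
        have h3 : (cpx X)ᵀ = cpx Xᵀ := rfl
        rw [h3, ← cpx_mul, transpose_mul_of_mem_orthogonalGroup hX]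
        simp
      rw [transpose_mul, Matrix.mul_assoc, ← Matrix.mul_assoc _ _ W, h2, Matrix.one_mul]
    rw [hXW, transpose_smul, Matrix.smul_mul, Matrix.mul_smul, smul_smul] at h1
    have h2 : (z * z - 1) • (Wᵀ * W) = 0 := by rw [sub_smul, h1, one_smul, sub_self]
    refine (smul_eq_zero.1 h2).resolve_left fun h3 => ?_
    rcases mul_self_eq_one_iff.1 (sub_eq_zero.1 h3) with rfl | rfl <;> simp at hz
  let f : (Fin 3 → ℝ) →ₗ[ℝ] Matrix ι ι ℝ :=
    { toFun := fun t => matrixRe (W * specialUnitaryParam t * Wᴴ)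
      map_add' := fun s t => by
        rw [map_add, Matrix.mul_add, Matrix.add_mul, map_add]
      map_smul' := fun c t => by
        rw [map_smul, Matrix.mul_smul, Matrix.smul_mul, map_smul]; rfl }
  have hfr := finrank_le_skewCodim f (X := X) (fun t => ?_) (fun t ht => ?_)
  · simpa using hfr
  · refine mem_skewCentralizer.2 ⟨?_, ?_⟩
    · change (matrixRe (W * specialUnitaryParam t * Wᴴ))ᵀ =
        -matrixRe (W * specialUnitaryParam t * Wᴴ)
      have h1 : (W * specialUnitaryParam t * Wᴴ)ᴴ = -(W * specialUnitaryParam t * Wᴴ) := by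
        rw [conjTranspose_mul, conjTranspose_mul, conjTranspose_conjTranspose,
          specialUnitaryParam_conjTranspose, Matrix.neg_mul, Matrix.mul_neg, Matrix.mul_assoc]
      ext i j
      have h2 := congrArg Complex.re (congrFun (congrFun h1 i) j)
      simpa [matrixRe_apply] using h2
    · set M := W * specialUnitaryParam t * Wᴴ with hM
      have h1 : cpx X * M = M * cpx X := by
        rw [hM, Matrix.mul_assoc (W * _), hWX, Matrix.mul_smul, ← Matrix.mul_assoc,
          ← Matrix.mul_assoc, hXW, Matrix.smul_mul, Matrix.smul_mul]
      change X * matrixRe M = matrixRe M * X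
      ext i j
      have h2 := congrArg Complex.re (congrFun (congrFun h1 i) j)
      simpa [Matrix.mul_apply, matrixRe_apply] using h2
  · obtain ⟨-, hadj⟩ := mem_skewAdjoin.1 ht
    obtain ⟨q, hq⟩ := exists_polynomial_of_mem_adjoin hadj
    set M := W * specialUnitaryParam t * Wᴴ with hM
    change ∀ (z : ℂ) (v : ι → ℂ), cpx X *ᵥ v = z • v → cpx (matrixRe M) *ᵥ v = _ at hq
    have h1 : cpx (matrixRe M) * W = Polynomial.aeval z q • W := by
      ext i j
      have hcol : cpx X *ᵥ (fun i => W i j) = z • fun i => W i j := by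
        funext i
        have := congrFun (congrFun hXW i) j
        simpa [Matrix.mul_apply, mulVec, dotProduct] using this
      have := congrFun (hq z _ hcol) i
      simpa [Matrix.mul_apply, mulVec, dotProduct] using this
    have h2 : M * W = W * specialUnitaryParam t := by
      rw [hM, Matrix.mul_assoc, hW, Matrix.mul_one]
    have h3 : M.map (starRingEnd ℂ) * W = 0 := by
      have h4 : M.map (starRingEnd ℂ) = W.map (starRingEnd ℂ) *
          (specialUnitaryParam t).map (starRingEnd ℂ) * Wᵀ := by
        rw [hM, Matrix.map_mul, Matrix.map_mul]
        congr 1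
        ext i j; simp
      rw [h4, Matrix.mul_assoc, hWW, Matrix.mul_zero]
    have h5 : W * specialUnitaryParam t = (2 * Polynomial.aeval z q) • W := by
      have h6 := congrArg (· * W) (cpx_matrixRe M)
      simp only [Matrix.add_mul, Matrix.smul_mul, h1, h2, h3, add_zero, smul_smul] at h6
      exact h6.symm
    apply eq_zero_of_specialUnitaryParam_eq (a := 2 * Polynomial.aeval z q)
    calc specialUnitaryParam t = Wᴴ * (W * specialUnitaryParam t) := by
          rw [← Matrix.mul_assoc, hW, Matrix.one_mul]
      _ = _ := by rw [h5, Matrix.mul_smul, hW]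

end LowerBounds

/-! ### Odd multiplicity of 1 and -1 forced by the determinant -/

section Parity

open Matrix Polynomial

variable {ι : Type*} [Fintype ι] [DecidableEq ι]

/-- A negative value at 0 would give a nonnegative root, by the intermediate value theorem. -/
theorem Polynomial.Monic.eval_zero_pos {q : ℝ[X]} (hq : q.Monic)
    (h : ∀ x, 0 ≤ x → q.eval x ≠ 0) : 0 < q.eval 0 := by
  by_contra hneg
  have h0 : q.eval 0 < 0 := lt_of_le_of_ne (not_lt.1 hneg) (h 0 le_rfl)
  have hdeg : 0 < q.degree := by
    by_contra hd
    rw [eq_C_of_degree_le_zero (not_lt.1 hd)] at hq h0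
    rw [Monic, leadingCoeff_C] at hq
    rw [hq] at h0
    norm_num at h0
  have hlim := q.tendsto_atTop_of_leadingCoeff_nonneg hdeg (by rw [hq.leadingCoeff]; norm_num)
  obtain ⟨b, hb0, hb⟩ := ((eventually_ge_atTop (0 : ℝ)).and (hlim.eventually_ge_atTop 0)).exists
  obtain ⟨x, hx, hx0⟩ := intermediate_value_Icc hb0 q.continuous.continuousOn ⟨h0.le, hb⟩
  exact h x hx.1 hx0

theorem real_eigenvalue_mul_self {X : Matrix ι ι ℝ} (hX : X ∈ orthogonalGroup ι ℝ) {x : ℝ}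
    (hx : X.charpoly.eval x = 0) : x * x = 1 := by
  rw [eval_charpoly] at hx
  obtain ⟨v, hv, h0⟩ := exists_mulVec_eq_zero_iff.2 hx
  have h1 : X *ᵥ v = x • v := by
    rw [sub_mulVec, sub_eq_zero] at h0
    rw [← h0, scalar_apply, ← smul_one_eq_diagonal, smul_mulVec, one_mulVec]
  have h2 : (X *ᵥ v) ⬝ᵥ (X *ᵥ v) = v ⬝ᵥ v := by
    rw [dotProduct_mulVec, vecMul_mulVec, ← dotProduct_mulVec]
    rw [transpose_mul_of_mem_orthogonalGroup hX, one_mulVec]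
  rw [h1, smul_dotProduct, dotProduct_smul, smul_eq_mul, smul_eq_mul, ← mul_assoc] at h2
  have h3 : v ⬝ᵥ v ≠ 0 := fun h => hv (dotProduct_self_eq_zero.1 h)
  exact mul_right_cancel₀ h3 (by rw [h2, one_mul])

/-- Write the characteristic polynomial as (x - 1)^k q(x). Real eigenvalues are ±1, so q has no
nonnegative root and q(0) > 0. The value at 0 is det(-X) = -1 = (-1)^k q(0), hence k is odd. -/
theorem odd_finrank_eigenspace_one {X : Matrix ι ι ℝ} (hX : X ∈ orthogonalGroup ι ℝ)
    (hdet : (-X).det = -1) : Odd (Module.finrank ℝ (eigenspace (toLin' X) 1)) := by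
  rw [finrank_eigenspace_eq_rootMultiplicity (commute_conjTranspose_of_mem_orthogonalGroup hX)]
  set k := X.charpoly.rootMultiplicity 1 with hk
  obtain ⟨q, hq, hq1⟩ := exists_eq_pow_rootMultiplicity_mul_and_not_dvd X.charpoly
    X.charpoly_monic.ne_zero 1
  rw [← hk] at hq
  have hqm : q.Monic := by
    have h1 : ((Polynomial.X - C (1 : ℝ)) ^ k).Monic := (monic_X_sub_C 1).pow k
    exact h1.of_mul_monic_left (hq ▸ X.charpoly_monic)
  have hpos : 0 < q.eval 0 := by
    apply hqm.eval_zero_pos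
    intro x hx hx0
    have h1 : X.charpoly.eval x = 0 := by rw [hq, eval_mul, hx0, mul_zero]
    have h2 := real_eigenvalue_mul_self hX h1
    have h3 : x = 1 := by
      rcases mul_self_eq_one_iff.1 h2 with h | h
      · exact h
      · linarith
    rw [h3] at hx0
    exact hq1 (dvd_iff_isRoot.2 hx0)
  have h0 : X.charpoly.eval 0 = -1 := by
    rw [eval_charpoly, map_zero, zero_sub, hdet]
  rw [hq, eval_mul, eval_pow] at h0
  rcases Nat.even_or_odd k with he | ho
  · rw [eval_sub, eval_X, eval_C, zero_sub, he.neg_one_pow, one_mul] at h0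
    linarith
  · exact ho

theorem odd_finrank_eigenspace_neg_one {X : Matrix ι ι ℝ} (hX : X ∈ orthogonalGroup ι ℝ)
    (hdet : X.det = -1) : Odd (Module.finrank ℝ (eigenspace (toLin' X) (-1))) := by
  have hneg : -X ∈ orthogonalGroup ι ℝ := by
    apply mem_orthogonalGroup_of_mul_transpose
    rw [transpose_neg, neg_mul_neg, mul_transpose_of_mem_orthogonalGroup hX]
  have h := odd_finrank_eigenspace_one hneg (by rwa [neg_neg])
  have heq : eigenspace (toLin' (-X)) (1 : ℝ) = eigenspace (toLin' X) (-1) := by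
    ext v
    rw [mem_eigenspace_iff, mem_eigenspace_iff, toLin'_apply, toLin'_apply, neg_mulVec, one_smul,
      neg_smul, one_smul, neg_eq_iff_eq_neg]
  rwa [heq] at h

theorem finrank_eigenspace_cpx_ofReal {X : Matrix ι ι ℝ} (hX : X ∈ orthogonalGroup ι ℝ) (z : ℝ) :
    Module.finrank ℂ (eigenspace (toLin' (cpx X)) z) =
      Module.finrank ℝ (eigenspace (toLin' X) z) := by
  rw [finrank_eigenspace_eq_rootMultiplicity (commute_conjTranspose_of_mem_orthogonalGroup hX),
    finrank_eigenspace_eq_rootMultiplicity (cpx_commute_conjTranspose hX), charpoly_map]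
  exact (eq_rootMultiplicity_map (algebraMap ℝ ℂ).injective z).symm

theorem one_le_skewCodim {X : Matrix ι ι ℝ} (hX : X ∈ orthogonalGroup ι ℝ) {z : ℂ}
    (h : 2 ≤ (cpx X).charpoly.rootMultiplicity z) : 1 ≤ skewCodim X := by
  rw [rootMultiplicity_cpx hX] at h
  by_cases hz : z.im = 0
  · obtain ⟨v, hv, hvz⟩ := exists_eigenvector_of_two_le h
    obtain ⟨x, hx, rfl⟩ : ∃ x : ℝ, (x = 1 ∨ x = -1) ∧ z = (x : ℂ) := by
      rcases eigenvalue_eq_one_or_neg_one hX hv hvz hz with rfl | rfl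
      · exact ⟨1, Or.inl rfl, by simp⟩
      · exact ⟨-1, Or.inr rfl, by simp⟩
    rw [finrank_eigenspace_cpx_ofReal hX] at h
    exact one_le_finrank_skewSubmodule.trans (finrank_skewSubmodule_le_skewCodim hX hx h)
  · exact (by norm_num : 1 ≤ 3).trans (three_le_skewCodim_of_nonreal hX hz h)

/-- At ±1 the determinant condition makes the multiplicity odd, hence at least 3, and so(3) has
dimension 3; nonreal eigenvalues contribute su(2). -/
theorem three_le_skewCodim {X : Matrix ι ι ℝ} (hX : X ∈ orthogonalGroup ι ℝ) {z : ℂ}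
    (h : 2 ≤ (cpx X).charpoly.rootMultiplicity z) (h1 : z = 1 → (-X).det = -1)
    (h2 : z = -1 → X.det = -1) : 3 ≤ skewCodim X := by
  rw [rootMultiplicity_cpx hX] at h
  by_cases hz : z.im = 0
  · obtain ⟨v, hv, hvz⟩ := exists_eigenvector_of_two_le h
    obtain ⟨x, hx, rfl, hodd⟩ : ∃ x : ℝ, (x = 1 ∨ x = -1) ∧ z = (x : ℂ) ∧
        Odd (Module.finrank ℝ (eigenspace (toLin' X) x)) := by
      rcases eigenvalue_eq_one_or_neg_one hX hv hvz hz with rfl | rfl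
      · exact ⟨1, Or.inl rfl, by simp, odd_finrank_eigenspace_one hX (h1 rfl)⟩
      · exact ⟨-1, Or.inr rfl, by simp, odd_finrank_eigenspace_neg_one hX (h2 rfl)⟩
    rw [finrank_eigenspace_cpx_ofReal hX] at h
    have h3 : 3 ≤ Module.finrank ℝ (eigenspace (toLin' X) x) := by
      obtain ⟨k, hk⟩ := hodd
      omega
    exact three_le_finrank_skewSubmodule.trans (finrank_skewSubmodule_le_skewCodim hX hx h3)
  · exact three_le_skewCodim_of_nonreal hX hz h

end Parity

/-! ### Block rotation models and their commutants -/

section Models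

open Matrix

theorem two_le_finrank_eigenspace {ι 𝕜 : Type*} [Fintype ι] [DecidableEq ι] [Field 𝕜]
    {A : Matrix ι ι 𝕜} {z : 𝕜} {v w : ι → 𝕜} (hv : A *ᵥ v = z • v) (hw : A *ᵥ w = z • w)
    (hvw : ∀ s t : 𝕜, s • v + t • w = 0 → s = 0 ∧ t = 0) :
    2 ≤ Module.finrank 𝕜 (eigenspace (toLin' A) z) := by
  have hv' : v ∈ eigenspace (toLin' A) z := mem_eigenspace_iff.2 (by rw [toLin'_apply, hv])
  have hw' : w ∈ eigenspace (toLin' A) z := mem_eigenspace_iff.2 (by rw [toLin'_apply, hw])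
  have hlin : LinearIndependent 𝕜 ![(⟨v, hv'⟩ : eigenspace (toLin' A) z), ⟨w, hw'⟩] :=
    LinearIndependent.pair_iff.2 fun s t h => hvw s t (congrArg Subtype.val h)
  simpa using hlin.fintype_card_le_finrank

theorem aeval_diagonal {ι : Type*} [Fintype ι] [DecidableEq ι] (h : ι → ℝ) (p : Polynomial ℝ) :
    Polynomial.aeval (diagonal h) p = diagonal fun i => p.eval (h i) := by
  have h1 := Polynomial.aeval_algHom_apply (diagonalAlgHom ℝ : (ι → ℝ) →ₐ[ℝ] Matrix ι ι ℝ) h p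
  have h2 : (diagonalAlgHom ℝ : (ι → ℝ) →ₐ[ℝ] Matrix ι ι ℝ) h = diagonal h := rfl
  rw [h2] at h1
  rw [h1]
  change diagonal (Polynomial.aeval h p) = _
  congr 1
  funext i
  rw [← Polynomial.coe_aeval_eq_eval]
  exact (Polynomial.aeval_algHom_apply (Pi.evalAlgHom ℝ (fun _ : ι => ℝ) i) h p).symm

variable {j k : ℕ}

/-- The cosines of the rotation angles of the model matrices. -/
noncomputable def modelCos (r : Fin k → ℕ) (a : Fin k) : ℝ := 1 / ((r a : ℝ) + 2)

/-- The sines of the rotation angles of the model matrices. -/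
noncomputable def modelSin (r : Fin k → ℕ) (a : Fin k) : ℝ := √(1 - modelCos r a * modelCos r a)

/-- An orthogonal matrix in normal form: real eigenvalues `e i`, and plane rotations with cosines
`1 / (r a + 2)`. -/
noncomputable def modelMatrix (e : Fin j → ℝ) (r : Fin k → ℕ) :
    Matrix (Fin j ⊕ Fin 2 × Fin k) (Fin j ⊕ Fin 2 × Fin k) ℝ :=
  fromBlocks (diagonal e) 0 0
    (blockDiagonal fun a => !![modelCos r a, -modelSin r a; modelSin r a, modelCos r a])

variable {e : Fin j → ℝ} {r : Fin k → ℕ}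

theorem modelCos_pos (a : Fin k) : 0 < modelCos r a := by
  unfold modelCos; positivity

theorem modelCos_lt_one (a : Fin k) : modelCos r a < 1 := by
  unfold modelCos
  rw [div_lt_one (by positivity)]
  have : (0 : ℝ) ≤ r a := Nat.cast_nonneg _
  linarith

theorem modelSin_pos (a : Fin k) : 0 < modelSin r a := by
  have h1 := modelCos_pos (r := r) a
  have h2 := modelCos_lt_one (r := r) a
  exact Real.sqrt_pos.2 (by nlinarith)

theorem modelCos_sq_add (a : Fin k) :
    modelCos r a * modelCos r a + modelSin r a * modelSin r a = 1 := by
  have h1 := modelCos_pos (r := r) a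
  have h2 := modelCos_lt_one (r := r) a
  rw [modelSin, Real.mul_self_sqrt (by nlinarith)]
  ring

/-- Angles are labelled by natural numbers, so coincidences of nonreal eigenvalues are decided by r.
-/
theorem modelCos_eq_iff {a b : Fin k} : modelCos r a = modelCos r b ↔ r a = r b := by
  refine ⟨fun h => ?_, fun h => by rw [modelCos, modelCos, h]⟩
  rw [modelCos, modelCos, one_div, one_div, _root_.inv_inj] at h
  exact_mod_cast add_right_cancel h

theorem modelMatrix_mem_orthogonalGroup (he : ∀ i, e i = 1 ∨ e i = -1) :
    modelMatrix e r ∈ orthogonalGroup _ ℝ := by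
  apply mem_orthogonalGroup_of_mul_transpose
  rw [modelMatrix, fromBlocks_transpose, fromBlocks_multiply, ← fromBlocks_one]
  congr 1
  · rw [diagonal_transpose, diagonal_mul_diagonal]
    simp only [transpose_zero, Matrix.mul_zero, add_zero]
    rw [← diagonal_one]
    congr 1
    funext i
    rcases he i with h | h <;> rw [h] <;> norm_num
  · simp
  · simp
  · rw [blockDiagonal_transpose, ← blockDiagonal_mul]
    simp only [Matrix.zero_mul, transpose_zero, zero_add]
    rw [← blockDiagonal_one]
    congr 1
    funext a
    have := modelCos_sq_add (r := r) a
    ext i j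
    fin_cases i <;> fin_cases j <;> simp [Matrix.mul_apply, Fin.sum_univ_two] <;> linarith

theorem det_modelMatrix : (modelMatrix e r).det = ∏ i, e i := by
  rw [modelMatrix, det_fromBlocks_zero₂₁, det_diagonal, det_blockDiagonal]
  rw [Finset.prod_eq_one (s := Finset.univ) (f := fun a : Fin k => det _), mul_one]
  intro a _
  rw [det_fin_two_of]
  have := modelCos_sq_add (r := r) a
  linarith

/-- The diagonal of the symmetrized model matrix. -/
noncomputable def modelDiag (e : Fin j → ℝ) (r : Fin k → ℕ) : Fin j ⊕ Fin 2 × Fin k → ℝ :=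
  Sum.elim (fun i => 2 * e i) fun p => 2 * modelCos r p.2

theorem modelMatrix_add_transpose :
    modelMatrix e r + (modelMatrix e r)ᵀ = diagonal (modelDiag e r) := by
  ext x y
  rcases x with i | ⟨t, a⟩ <;> rcases y with i' | ⟨u, b⟩
  · by_cases h : i = i'
    · subst h; simp [modelMatrix, modelDiag]; ring
    · simp [modelMatrix, h, Ne.symm h]
  · simp [modelMatrix]
  · simp [modelMatrix]
  · by_cases h : a = b
    · subst h
      fin_cases t <;> fin_cases u <;> simp [modelMatrix, modelDiag, blockDiagonal_apply] <;> ring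
    · simp [modelMatrix, blockDiagonal_apply, h, Ne.symm h]

/-- Twice the skew-symmetric part of the model matrix. -/
noncomputable def modelSkew (j : ℕ) (r : Fin k → ℕ) :
    Matrix (Fin j ⊕ Fin 2 × Fin k) (Fin j ⊕ Fin 2 × Fin k) ℝ :=
  fromBlocks 0 0 0 (blockDiagonal fun a => !![0, -(2 * modelSin r a); 2 * modelSin r a, 0])

theorem modelMatrix_sub_transpose :
    modelMatrix e r - (modelMatrix e r)ᵀ = modelSkew j r := by
  ext x y
  rcases x with i | ⟨t, a⟩ <;> rcases y with i' | ⟨u, b⟩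
  · by_cases h : i = i'
    · subst h; simp [modelMatrix, modelSkew]
    · simp [modelMatrix, modelSkew, h, Ne.symm h]
  · simp [modelMatrix, modelSkew]
  · simp [modelMatrix, modelSkew]
  · by_cases h : a = b
    · subst h
      fin_cases t <;> fin_cases u <;> simp [modelMatrix, modelSkew, blockDiagonal_apply] <;> ring
    · simp [modelMatrix, modelSkew, blockDiagonal_apply, h, Ne.symm h]

section Commutant

variable {Y : Matrix (Fin j ⊕ Fin 2 × Fin k) (Fin j ⊕ Fin 2 × Fin k) ℝ}

theorem commute_transpose_of_skew {ι : Type*} [Fintype ι] [DecidableEq ι] {M Y : Matrix ι ι ℝ}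
    (hY : Yᵀ = -Y) (h : Commute M Y) : Commute Mᵀ Y := by
  have := congrArg transpose h.eq
  rw [transpose_mul, transpose_mul, hY, neg_mul, mul_neg, neg_inj] at this
  exact this.symm

/-- A skew Y commuting with M also commutes with Mᵀ, hence with the diagonal matrix M + Mᵀ. -/
theorem apply_eq_zero_of_modelDiag_ne (hY : Yᵀ = -Y) (h : Commute (modelMatrix e r) Y)
    {x y : Fin j ⊕ Fin 2 × Fin k} (hxy : modelDiag e r x ≠ modelDiag e r y) : Y x y = 0 := by
  have h1 := (h.add_left (commute_transpose_of_skew hY h)).eq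
  rw [modelMatrix_add_transpose] at h1
  have h2 := congrFun (congrFun h1 x) y
  rw [diagonal_mul, mul_diagonal] at h2
  have h3 : (modelDiag e r x - modelDiag e r y) * Y x y = 0 := by rw [sub_mul, h2]; ring
  exact (mul_eq_zero.1 h3).resolve_left (sub_ne_zero.2 hxy)

theorem modelDiag_inl_ne_inr (he : ∀ i, e i = 1 ∨ e i = -1) (i : Fin j) (p : Fin 2 × Fin k) :
    modelDiag e r (Sum.inl i) ≠ modelDiag e r (Sum.inr p) := by
  have h1 := modelCos_pos (r := r) p.2
  have h2 := modelCos_lt_one (r := r) p.2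
  simp only [modelDiag, Sum.elim_inl, Sum.elim_inr]
  rcases he i with h | h <;> rw [h] <;> intro h' <;> linarith

theorem modelSkew_mul_apply_zero (a : Fin k) (x) :
    (modelSkew j r * Y) (Sum.inr (0, a)) x = -(2 * modelSin r a) * Y (Sum.inr (1, a)) x := by
  simp [Matrix.mul_apply, modelSkew, Fintype.sum_prod_type, blockDiagonal_apply]

theorem mul_modelSkew_apply_zero (b : Fin k) (x) :
    (Y * modelSkew j r) x (Sum.inr (0, b)) = Y x (Sum.inr (1, b)) * (2 * modelSin r b) := by
  simp [Matrix.mul_apply, modelSkew, Fintype.sum_prod_type, blockDiagonal_apply]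

theorem mul_modelSkew_apply_one (b : Fin k) (x) :
    (Y * modelSkew j r) x (Sum.inr (1, b)) = -(Y x (Sum.inr (0, b)) * (2 * modelSin r b)) := by
  simp [Matrix.mul_apply, modelSkew, Fintype.sum_prod_type, blockDiagonal_apply]

/-- Y also commutes with M - Mᵀ, so a 2 × 2 block between planes of equal angle commutes with the
quarter turn and represents a complex number. -/
theorem commute_block_relations (hY : Yᵀ = -Y) (h : Commute (modelMatrix e r) Y) {a b : Fin k}
    (hab : r a = r b) : Y (Sum.inr (1, a)) (Sum.inr (0, b)) = -Y (Sum.inr (0, a)) (Sum.inr (1, b)) ∧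
      Y (Sum.inr (1, a)) (Sum.inr (1, b)) = Y (Sum.inr (0, a)) (Sum.inr (0, b)) := by
  have h1 := (h.sub_left (commute_transpose_of_skew hY h)).eq
  rw [modelMatrix_sub_transpose] at h1
  have hs : modelSin r a = modelSin r b := by
    rw [modelSin, modelSin, modelCos_eq_iff.2 hab]
  have hpos := modelSin_pos (r := r) b
  have h2 := congrFun (congrFun h1 (Sum.inr (0, a))) (Sum.inr (0, b))
  have h3 := congrFun (congrFun h1 (Sum.inr (0, a))) (Sum.inr (1, b))
  rw [modelSkew_mul_apply_zero, mul_modelSkew_apply_zero, hs] at h2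
  rw [modelSkew_mul_apply_zero, mul_modelSkew_apply_one, hs] at h3
  constructor
  · apply mul_left_cancel₀ hpos.ne'; linarith
  · apply mul_left_cancel₀ hpos.ne'; linarith

/-- A matrix commuting with the model matrix that acts as a scalar on each of its eigenspaces is a
polynomial in the model matrix. -/
theorem mem_adjoin_modelMatrix (he : ∀ i, e i = 1 ∨ e i = -1) (hY : Yᵀ = -Y)
    (h : Commute (modelMatrix e r) Y) (h1 : ∀ i i', Y (Sum.inl i) (Sum.inl i') = 0)
    (h2 : ∀ a b, a ≠ b → r a = r b → ∀ t u, Y (Sum.inr (t, a)) (Sum.inr (u, b)) = 0)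
    (h3 : ∀ a b, r a = r b →
      Y (Sum.inr (0, a)) (Sum.inr (1, a)) = Y (Sum.inr (0, b)) (Sum.inr (1, b))) :
    Y ∈ Algebra.adjoin ℝ {modelMatrix e r} := by
  classical
  set M := modelMatrix e r with hM
  have hskew : ∀ x y, Y x y = -Y y x := fun x y => by
    have := congrFun (congrFun hY y) x
    simpa using this
  -- On each rotation plane Y is a multiple of M - Mᵀ, and G records that factor as a function of
  -- the eigenvalue 2 cos of M + Mᵀ; `h3` makes the choice immaterial. Thus Y = p(M + Mᵀ)(M - Mᵀ),
  -- and the values of G at ±2 do not matter since M - Mᵀ vanishes there.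
  let G : ℝ → ℝ := fun x => if hx : ∃ a, 2 * modelCos r a = x then
    -(Y (Sum.inr (0, hx.choose)) (Sum.inr (1, hx.choose)) / (2 * modelSin r hx.choose)) else 0
  have hG : ∀ a, G (2 * modelCos r a) =
      -(Y (Sum.inr (0, a)) (Sum.inr (1, a)) / (2 * modelSin r a)) := by
    intro a
    have hx : ∃ b, 2 * modelCos r b = 2 * modelCos r a := ⟨a, rfl⟩
    have hc : modelCos r hx.choose = modelCos r a := by linarith [hx.choose_spec]
    have hs : modelSin r hx.choose = modelSin r a := by rw [modelSin, modelSin, hc]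
    have hGa : G (2 * modelCos r a) = -(Y (Sum.inr (0, hx.choose)) (Sum.inr (1, hx.choose)) /
      (2 * modelSin r hx.choose)) := dif_pos hx
    rw [hGa, hs, h3 _ a (modelCos_eq_iff.1 hc)]
  set p := Lagrange.interpolate (Finset.univ.image (modelDiag e r)) id G with hp
  have hpe : ∀ x, p.eval (modelDiag e r x) = G (modelDiag e r x) := fun x =>
    Lagrange.eval_interpolate_at_node (v := id) G (Set.injOn_id _)
      (Finset.mem_image_of_mem _ (Finset.mem_univ x))
  have hYeq : Y = Polynomial.aeval (M + Mᵀ) p * (M - Mᵀ) := by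
    rw [hM, modelMatrix_add_transpose, modelMatrix_sub_transpose, aeval_diagonal]
    simp only [hpe]
    ext x y
    rw [diagonal_mul]
    rcases x with i | ⟨t, a⟩ <;> rcases y with i' | ⟨u, b⟩
    · simp [h1, modelSkew]
    · rw [apply_eq_zero_of_modelDiag_ne hY h (modelDiag_inl_ne_inr he i (u, b))]
      simp [modelSkew]
    · rw [apply_eq_zero_of_modelDiag_ne hY h (modelDiag_inl_ne_inr he i' (t, a)).symm]
      simp [modelSkew]
    · by_cases hab : a = b
      · subst hab
        have hpos := modelSin_pos (r := r) a
        have hrel := commute_block_relations hY h (a := a) (b := a) rfl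
        have hd : modelDiag e r (Sum.inr (t, a)) = 2 * modelCos r a := rfl
        have hdiag : ∀ x, Y x x = 0 := fun x => by linarith [hskew x x]
        rw [hd, hG]
        fin_cases t <;> fin_cases u
        · simp [modelSkew, blockDiagonal_apply, hdiag]
        · simp [modelSkew, blockDiagonal_apply]; field_simp
        · simp [modelSkew, blockDiagonal_apply, hrel.1]; field_simp
        · simp [modelSkew, blockDiagonal_apply, hdiag]
      · have h0 : Y (Sum.inr (t, a)) (Sum.inr (u, b)) = 0 := by
          by_cases hr : r a = r b
          · exact h2 a b hab hr t u
          · refine apply_eq_zero_of_modelDiag_ne hY h fun hd => hr ?_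
            simp only [modelDiag, Sum.elim_inr] at hd
            exact modelCos_eq_iff.1 (by linarith)
        rw [h0]
        simp [modelSkew, blockDiagonal_apply, hab]
  have hself := Algebra.self_mem_adjoin_singleton ℝ M
  have hinv : Mᵀ ∈ Algebra.adjoin ℝ {M} := by
    rw [← inv_eq_right_inv (mul_transpose_of_mem_orthogonalGroup
      (modelMatrix_mem_orthogonalGroup he))]
    exact inv_mem_subalgebra hself
  rw [hYeq]
  refine mul_mem ?_ (sub_mem hself hinv)
  exact Algebra.adjoin_le (Set.singleton_subset_iff.2 (add_mem hself hinv))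
    (Polynomial.aeval_mem_adjoin_singleton ℝ (M + Mᵀ))

end Commutant

end Models

/-! ### Examples attaining the codimension -/

section Examples

open Matrix

variable {j k : ℕ} {e : Fin j → ℝ} {r : Fin k → ℕ}

theorem exists_mem_orthogonalWithDet {ι : Type*} [Fintype ι] [DecidableEq ι] {n c : ℕ} {δ : ℝ}
    (hn : Fintype.card ι = n) {M : Matrix ι ι ℝ} (hM : M ∈ orthogonalGroup ι ℝ) (hdet : M.det = δ)
    {Q : ℂ → Prop} (hQ : HasDoubleEigenvalue Q M) (hc : skewCodim M ≤ c) :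
    ∃ X ∈ orthogonalWithDet n δ, HasDoubleEigenvalue Q X ∧ skewCodim X ≤ c := by
  let σ : ι ≃ Fin n := Fintype.equivFinOfCardEq hn
  refine ⟨reindexAlgEquiv ℝ ℝ σ M, ⟨?_, ?_⟩, ?_, ?_⟩
  · apply mem_orthogonalGroup_of_mul_transpose
    have h1 : (reindexAlgEquiv ℝ ℝ σ M)ᵀ = reindexAlgEquiv ℝ ℝ σ Mᵀ := rfl
    rw [h1, ← map_mul, mul_transpose_of_mem_orthogonalGroup hM, map_one]
  · rw [coe_reindexAlgEquiv, det_reindex_self, hdet]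
  · have h1 : cpx (reindexAlgEquiv ℝ ℝ σ M) = reindex σ σ (cpx M) := rfl
    rw [HasDoubleEigenvalue, h1, charpoly_reindex]
    exact hQ
  · rw [skewCodim_algEquiv _ _ (fun _ => rfl)]
    exact hc

theorem hasDoubleEigenvalue_modelMatrix_real (he : ∀ i, e i = 1 ∨ e i = -1) {i i' : Fin j}
    (hne : i ≠ i') (heq : e i = e i') {Q : ℂ → Prop} (hQ : Q (e i)) :
    HasDoubleEigenvalue Q (modelMatrix e r) := by
  have hM := modelMatrix_mem_orthogonalGroup (r := r) he
  refine ⟨e i, hQ, ?_⟩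
  rw [rootMultiplicity_cpx hM, finrank_eigenspace_cpx_ofReal hM]
  have hev : ∀ l, modelMatrix e r *ᵥ Pi.single (Sum.inl l) 1 =
      e l • (Pi.single (Sum.inl l) 1 : Fin j ⊕ Fin 2 × Fin k → ℝ) := by
    intro l
    rw [mulVec_single_one]
    funext x
    rcases x with x | x
    · by_cases h : x = l
      · subst h; simp [modelMatrix]
      · simp [modelMatrix, h]
    · simp [modelMatrix]
  refine two_le_finrank_eigenspace (hev i) (heq ▸ hev i') fun s t h => ?_
  have h1 := congrFun h (Sum.inl i)
  have h2 := congrFun h (Sum.inl i')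
  simp [hne, hne.symm] at h1 h2
  exact ⟨h1, h2⟩

/-- An eigenvector of a block rotation. -/
noncomputable def modelVec (j : ℕ) (a : Fin k) : Fin j ⊕ Fin 2 × Fin k → ℂ :=
  Sum.elim 0 fun p => if p.2 = a then ![1, -Complex.I] p.1 else 0

theorem cpx_modelMatrix_mulVec (a : Fin k) : cpx (modelMatrix e r) *ᵥ modelVec j a =
    ((modelCos r a : ℂ) + modelSin r a * Complex.I) • modelVec j a := by
  funext x
  rcases x with x | ⟨t, b⟩
  · simp [mulVec, dotProduct, modelMatrix, modelVec]
  · by_cases h : b = a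
    · subst h
      fin_cases t
      · simp [mulVec, dotProduct, modelMatrix, modelVec, Fintype.sum_prod_type,
          blockDiagonal_apply]
      · simp [mulVec, dotProduct, modelMatrix, modelVec, Fintype.sum_prod_type,
          blockDiagonal_apply]
        linear_combination (modelSin r b : ℂ) * Complex.I_mul_I
    · simp [mulVec, dotProduct, modelMatrix, modelVec, Fintype.sum_prod_type,
        blockDiagonal_apply, h]

theorem hasDoubleEigenvalue_modelMatrix_nonreal (he : ∀ i, e i = 1 ∨ e i = -1) {a b : Fin k}
    (hne : a ≠ b) (heq : r a = r b) :
    HasDoubleEigenvalue (fun z => z.im ≠ 0) (modelMatrix e r) := by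
  have hM := modelMatrix_mem_orthogonalGroup (r := r) he
  refine ⟨(modelCos r a : ℂ) + modelSin r a * Complex.I, ?_, ?_⟩
  · simpa using (modelSin_pos (r := r) a).ne'
  · rw [rootMultiplicity_cpx hM]
    have hb := cpx_modelMatrix_mulVec (e := e) (r := r) b
    have hc : modelCos r b = modelCos r a := modelCos_eq_iff.2 heq.symm
    have hs : modelSin r b = modelSin r a := by rw [modelSin, modelSin, hc]
    rw [hc, hs] at hb
    refine two_le_finrank_eigenspace (cpx_modelMatrix_mulVec a) hb fun s t h => ?_
    have h1 := congrFun h (Sum.inr (0, a))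
    have h2 := congrFun h (Sum.inr (0, b))
    simp [modelVec, hne, hne.symm] at h1 h2
    exact ⟨h1, h2⟩

/-- With distinct rotation angles, only the real eigenspaces contribute to the codimension. -/
theorem skewCodim_modelMatrix_le_of_injective (he : ∀ i, e i = 1 ∨ e i = -1)
    (hr : Function.Injective r) {c : ℕ} (u v : Fin c → Fin j)
    (huv : ∀ i i', i < i' → e i = e i' → ∃ l, u l = i ∧ v l = i') :
    skewCodim (modelMatrix e r) ≤ c := by
  -- The functionals are the entries above the diagonal inside the real eigenspaces, listed by u and
  -- v.
  let f : Matrix (Fin j ⊕ Fin 2 × Fin k) (Fin j ⊕ Fin 2 × Fin k) ℝ →ₗ[ℝ] (Fin c → ℝ) :=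
    { toFun := fun Y l => Y (Sum.inl (u l)) (Sum.inl (v l))
      map_add' := fun _ _ => rfl
      map_smul' := fun _ _ => rfl }
  refine skewCodim_le_of_ker f fun Y hY hcomm hf => ?_
  have hskew : ∀ x y, Y x y = -Y y x := fun x y => by
    have := congrFun (congrFun hY y) x
    simpa using this
  have hlt : ∀ i i', i < i' → Y (Sum.inl i) (Sum.inl i') = 0 := by
    intro i i' hii
    by_cases hee : e i = e i'
    · obtain ⟨l, rfl, rfl⟩ := huv i i' hii hee
      exact congrFun hf l
    · refine apply_eq_zero_of_modelDiag_ne hY hcomm fun h => hee ?_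
      simp only [modelDiag, Sum.elim_inl] at h
      linarith
  refine mem_adjoin_modelMatrix he hY hcomm (fun i i' => ?_)
    (fun a b hab hrab => absurd (hr hrab) hab) (fun a b hrab => by rw [hr hrab])
  rcases lt_trichotomy i i' with h | rfl | h
  · exact hlt i i' h
  · linarith [hskew (Sum.inl i) (Sum.inl i)]
  · rw [hskew, hlt i' i h, neg_zero]

/-- One repeated rotation angle contributes three to the codimension. -/
theorem skewCodim_modelMatrix_le_of_pair {r : Fin (k + 2) → ℕ} (he : ∀ i, e i = 1 ∨ e i = -1)
    (hinj : Function.Injective e)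
    (hr : ∀ a b, a < b → r a = r b → a = 0 ∧ b = 1) (h01 : r 0 = r 1) :
    skewCodim (modelMatrix e r) ≤ 3 := by
  -- The commutant on the repeated pair is u(2). The first two functionals are its complex
  -- off-diagonal entry, the third the difference of its diagonal entries, so the kernel is scalar
  -- there.
  let f : Matrix (Fin j ⊕ Fin 2 × Fin (k + 2)) (Fin j ⊕ Fin 2 × Fin (k + 2)) ℝ →ₗ[ℝ]
      (Fin 3 → ℝ) :=
    { toFun := fun Y => ![Y (Sum.inr (0, 0)) (Sum.inr (0, 1)), Y (Sum.inr (0, 0)) (Sum.inr (1, 1)),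
        Y (Sum.inr (0, 0)) (Sum.inr (1, 0)) - Y (Sum.inr (0, 1)) (Sum.inr (1, 1))]
      map_add' := fun _ _ => by
        funext i
        fin_cases i
        · rfl
        · rfl
        · simp; ring
      map_smul' := fun _ _ => by
        funext i
        fin_cases i
        · rfl
        · rfl
        · simp; ring }
  refine skewCodim_le_of_ker f fun Y hY hcomm hf => ?_
  have hskew : ∀ x y, Y x y = -Y y x := fun x y => by
    have := congrFun (congrFun hY y) x
    simpa using this
  have f0 : Y (Sum.inr (0, 0)) (Sum.inr (0, 1)) = 0 := congrFun hf 0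
  have f1 : Y (Sum.inr (0, 0)) (Sum.inr (1, 1)) = 0 := congrFun hf 1
  have f2 : Y (Sum.inr (0, 0)) (Sum.inr (1, 0)) = Y (Sum.inr (0, 1)) (Sum.inr (1, 1)) :=
    sub_eq_zero.1 (congrFun hf 2)
  obtain ⟨g0, g1⟩ := commute_block_relations hY hcomm h01
  rw [f1, neg_zero] at g0
  rw [f0] at g1
  have hlt : ∀ a b, a < b → r a = r b → ∀ t u, Y (Sum.inr (t, a)) (Sum.inr (u, b)) = 0 := by
    intro a b hab hrab t u
    obtain ⟨rfl, rfl⟩ := hr a b hab hrab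
    fin_cases t <;> fin_cases u
    exacts [f0, f1, g0, g1]
  refine mem_adjoin_modelMatrix he hY hcomm (fun i i' => ?_) (fun a b hab hrab t u => ?_)
    (fun a b hrab => ?_)
  · by_cases h : i = i'
    · subst h
      linarith [hskew (Sum.inl i) (Sum.inl i)]
    · refine apply_eq_zero_of_modelDiag_ne hY hcomm fun hd => h (hinj ?_)
      simp only [modelDiag, Sum.elim_inl] at hd
      linarith
  · rcases lt_or_gt_of_ne hab with h | h
    · exact hlt a b h hrab t u
    · rw [hskew, hlt b a h hrab.symm, neg_zero]
  · rcases lt_trichotomy a b with h | rfl | h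
    · obtain ⟨rfl, rfl⟩ := hr a b h hrab
      exact f2
    · rfl
    · obtain ⟨rfl, rfl⟩ := hr b a h hrab.symm
      exact f2.symm

end Examples

/-! ### Assembly of the five cases -/

theorem isDerogatory_iff {n : ℕ} {X : Matrix (Fin n) (Fin n) ℝ}
    (hX : X ∈ Matrix.orthogonalGroup (Fin n) ℝ) :
    IsDerogatory X ↔ HasDoubleEigenvalue (fun _ => True) X := by
  simp only [IsDerogatory, HasDoubleEigenvalue, rootMultiplicity_cpx hX, true_and]
  rfl

theorem hasCodimIn_hasDoubleEigenvalue {n c : ℕ} {δ : ℝ} (hδ : δ = 1 ∨ δ = -1) {Q : ℂ → Prop}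
    (hQ : ∀ z w : ℂ, Q z → (z.im = 0 ↔ w.im = 0) →
      (z.im = 0 → (z = 1 ∨ z = -1) ∧ (w = 1 ∨ w = -1)) → ‖w - z‖ < 2 → Q w)
    (hlow : ∀ X ∈ orthogonalWithDet n δ, ∀ z, Q z →
      2 ≤ (cpx X).charpoly.rootMultiplicity z → c ≤ skewCodim X)
    (hex : ∃ X ∈ orthogonalWithDet n δ, HasDoubleEigenvalue Q X ∧ skewCodim X ≤ c) :
    HasCodimIn {X ∈ orthogonalWithDet n δ | HasDoubleEigenvalue Q X} (orthogonalWithDet n δ) c :=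
  hasCodimIn_of_strata hδ hasDoubleEigenvalue_conj
    (fun _ hX hPX => ⟨2, two_pos, fun _ hY hadj hlt =>
      hasDoubleEigenvalue_stable hQ hX hY hadj hlt hPX⟩)
    (fun X hX ⟨z, hz, hm⟩ => hlow X hX z hz hm) hex

theorem hasCodimIn_isDerogatory {n c : ℕ} {δ : ℝ} (hδ : δ = 1 ∨ δ = -1)
    (hlow : ∀ X ∈ orthogonalWithDet n δ, ∀ z,
      2 ≤ (cpx X).charpoly.rootMultiplicity z → c ≤ skewCodim X)
    (hex : ∃ X ∈ orthogonalWithDet n δ,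
      HasDoubleEigenvalue (fun _ => True) X ∧ skewCodim X ≤ c) :
    HasCodimIn {X ∈ orthogonalWithDet n δ | IsDerogatory X} (orthogonalWithDet n δ) c := by
  have h : {X ∈ orthogonalWithDet n δ | IsDerogatory X} =
      {X ∈ orthogonalWithDet n δ | HasDoubleEigenvalue (fun _ => True) X} := by
    ext X
    exact and_congr_right fun hX => isDerogatory_iff hX.1
  rw [h]
  exact hasCodimIn_hasDoubleEigenvalue hδ (fun _ _ _ _ _ _ => trivial)
    (fun X hX z _ => hlow X hX z) hex

theorem det_neg_of_odd {n : ℕ} (hn : Odd n) (X : Matrix (Fin n) (Fin n) ℝ) :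
    (-X).det = -X.det := by
  rw [Matrix.det_neg, Fintype.card_fin, hn.neg_one_pow, neg_one_mul]

theorem det_neg_of_even {n : ℕ} (hn : Even n) (X : Matrix (Fin n) (Fin n) ℝ) :
    (-X).det = X.det := by
  rw [Matrix.det_neg, Fintype.card_fin, hn.neg_one_pow, one_mul]

theorem mainTheorem2 (n : ℕ) (δ : ℝ) (hδ : δ = 1 ∨ δ = -1) :
    (Even n → 2 ≤ n → δ = 1 →
      HasCodimIn {X ∈ orthogonalWithDet n δ | IsDerogatory X} (orthogonalWithDet n δ) 1) ∧
    (Even n → 4 ≤ n → δ = -1 →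
      HasCodimIn {X ∈ orthogonalWithDet n δ | IsDerogatory X} (orthogonalWithDet n δ) 3) ∧
    (Odd n → 3 ≤ n →
      HasCodimIn {X ∈ orthogonalWithDet n δ | IsDerogatory X} (orthogonalWithDet n δ) 1) ∧
    (Even n → 4 ≤ n → (δ = -1 → 6 ≤ n) →
      HasCodimIn {X ∈ orthogonalWithDet n δ | ∃ z : ℂ, z.im ≠ 0 ∧ IsDoubleEigenvalue X z}
        (orthogonalWithDet n δ) 3) ∧
    (Odd n → 3 ≤ n →
      HasCodimIn {X ∈ orthogonalWithDet n δ | ∃ z : ℂ, z ≠ -(δ : ℂ) ∧ IsDoubleEigenvalue X z}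
        (orthogonalWithDet n δ) 3) := by
  refine ⟨fun hn h2 h1 => ?_, fun hn h4 h1 => ?_, fun hn h3 => ?_, fun hn h4 h6 => ?_,
    fun hn h3 => ?_⟩
  · obtain ⟨m, rfl⟩ := hn
    refine hasCodimIn_isDerogatory hδ (fun X hX z hz => one_le_skewCodim hX.1 hz) ?_
    have he : ∀ i, (![1, 1] : Fin 2 → ℝ) i = 1 ∨ (![1, 1] : Fin 2 → ℝ) i = -1 := by
      intro i; fin_cases i <;> simp
    -- A double eigenvalue 1 and m - 1 distinct rotations, of total size 2m.
    refine exists_mem_orthogonalWithDet (M := modelMatrix ![1, 1] (fun a : Fin (m - 1) => (a : ℕ)))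
      (by simp; omega) (modelMatrix_mem_orthogonalGroup he) (by simp [det_modelMatrix, h1])
      (hasDoubleEigenvalue_modelMatrix_real he (i := 0) (i' := 1) (by simp) (by simp) trivial)
      (skewCodim_modelMatrix_le_of_injective he Fin.val_injective ![0] ![1] ?_)
    have hp : ∀ i i' : Fin 2, i < i' →
        ∃ l : Fin 1, (![0] : Fin 1 → Fin 2) l = i ∧ (![1] : Fin 1 → Fin 2) l = i' := by decide
    exact fun i i' h _ => hp i i' h
  · obtain ⟨m, rfl⟩ := hn
    refine hasCodimIn_isDerogatory hδ (fun X hX z hz => three_le_skewCodim hX.1 hz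
      (fun _ => ?_) (fun _ => ?_)) ?_
    · rw [det_neg_of_even ⟨m, rfl⟩, hX.2, h1]
    · rw [hX.2, h1]
    have he : ∀ i, (![1, 1, 1, -1] : Fin 4 → ℝ) i = 1 ∨ (![1, 1, 1, -1] : Fin 4 → ℝ) i = -1 := by
      intro i; fin_cases i <;> simp
    -- Both 1 and -1 have odd multiplicity here, so the cheapest real coincidence is a triple
    -- eigenvalue 1 beside a simple -1; it gives three pairs of indices.
    refine exists_mem_orthogonalWithDet
      (M := modelMatrix ![1, 1, 1, -1] (fun a : Fin (m - 2) => (a : ℕ)))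
      (by simp; omega) (modelMatrix_mem_orthogonalGroup he)
      (by simp [det_modelMatrix, h1, Fin.prod_univ_succ])
      (hasDoubleEigenvalue_modelMatrix_real he (i := 0) (i' := 1) (by simp) (by simp) trivial)
      (skewCodim_modelMatrix_le_of_injective he Fin.val_injective ![0, 0, 1] ![1, 2, 2] ?_)
    have hp : ∀ i i' : Fin 4, i < i' → i' ≠ 3 → ∃ l : Fin 3,
        (![0, 0, 1] : Fin 3 → Fin 4) l = i ∧ (![1, 2, 2] : Fin 3 → Fin 4) l = i' := by decide
    refine fun i i' h hee => hp i i' h ?_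
    rintro rfl
    have hne : (1 : ℝ) ≠ -1 := by norm_num
    fin_cases i
    · exact hne hee
    · exact hne hee
    · exact hne hee
    · exact absurd h (lt_irrefl _)
  · obtain ⟨m, rfl⟩ := hn
    refine hasCodimIn_isDerogatory hδ (fun X hX z hz => one_le_skewCodim hX.1 hz) ?_
    have he : ∀ i, (![-δ, -δ, δ] : Fin 3 → ℝ) i = 1 ∨ (![-δ, -δ, δ] : Fin 3 → ℝ) i = -1 := by
      intro i
      rcases hδ with rfl | rfl <;> fin_cases i <;> simp
    -- For n odd only -δ can have even multiplicity, so it is the one doubled.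
    refine exists_mem_orthogonalWithDet
      (M := modelMatrix ![-δ, -δ, δ] (fun a : Fin (m - 1) => (a : ℕ)))
      (by simp; omega) (modelMatrix_mem_orthogonalGroup he)
      (by rcases hδ with rfl | rfl <;> simp [det_modelMatrix, Fin.prod_univ_succ])
      (hasDoubleEigenvalue_modelMatrix_real he (i := 0) (i' := 1) (by simp) (by simp) trivial)
      (skewCodim_modelMatrix_le_of_injective he Fin.val_injective ![0] ![1] ?_)
    have hp : ∀ i i' : Fin 3, i < i' → i' ≠ 2 →
        ∃ l : Fin 1, (![0] : Fin 1 → Fin 3) l = i ∧ (![1] : Fin 1 → Fin 3) l = i' := by decide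
    refine fun i i' h hee => hp i i' h ?_
    rintro rfl
    have hne : -δ ≠ δ := by rcases hδ with rfl | rfl <;> norm_num
    fin_cases i
    · exact hne hee
    · exact hne hee
    · exact absurd h (lt_irrefl _)
  · obtain ⟨m, rfl⟩ := hn
    refine hasCodimIn_hasDoubleEigenvalue (Q := fun z => z.im ≠ 0) hδ
      (fun z w hz hzw _ _ hw => hz (hzw.2 hw))
      (fun X hX z hz hm => three_le_skewCodim hX.1 hm (fun h => ?_) (fun h => ?_)) ?_
    · simp [h] at hz
    · simp [h] at hz
    -- The labels a - 1 use truncated subtraction: indices 0 and 1 share label 0, and all others are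
    -- distinct.
    have hr : ∀ {k : ℕ} (a b : Fin (k + 2)), a < b → (a : ℕ) - 1 = (b : ℕ) - 1 →
        a = 0 ∧ b = 1 := by
      intro k a b hab h
      rw [Fin.lt_def] at hab
      refine ⟨Fin.ext ?_, Fin.ext ?_⟩
      · rw [Fin.val_zero]; omega
      · rw [Fin.val_one]; omega
    rcases hδ with rfl | rfl
    · have he : ∀ i, (![] : Fin 0 → ℝ) i = 1 ∨ (![] : Fin 0 → ℝ) i = -1 := fun i => i.elim0
      exact exists_mem_orthogonalWithDet
        (M := modelMatrix ![] (fun a : Fin (m - 2 + 2) => (a : ℕ) - 1))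
        (by simp; omega) (modelMatrix_mem_orthogonalGroup he) (by simp [det_modelMatrix])
        (hasDoubleEigenvalue_modelMatrix_nonreal he (a := 0) (b := 1) (by simp) (by simp))
        (skewCodim_modelMatrix_le_of_pair he (fun i => i.elim0) hr (by simp))
    · have he : ∀ i, (![1, -1] : Fin 2 → ℝ) i = 1 ∨ (![1, -1] : Fin 2 → ℝ) i = -1 := by
        intro i; fin_cases i <;> simp
      have := h6 rfl
      -- Determinant -1 requires the real pair 1, -1 besides two equal rotations, whence n ≥ 6.
      refine exists_mem_orthogonalWithDet
        (M := modelMatrix ![1, -1] (fun a : Fin (m - 3 + 2) => (a : ℕ) - 1))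
        (by simp; omega) (modelMatrix_mem_orthogonalGroup he) (by simp [det_modelMatrix])
        (hasDoubleEigenvalue_modelMatrix_nonreal he (a := 0) (b := 1) (by simp) (by simp))
        (skewCodim_modelMatrix_le_of_pair he ?_ hr (by simp))
      intro i i' h
      fin_cases i <;> fin_cases i' <;> first | rfl | norm_num at h
  · have hδ0 : (δ : ℂ) ≠ -(δ : ℂ) := by
      rcases hδ with rfl | rfl <;> norm_num
    refine hasCodimIn_hasDoubleEigenvalue (Q := fun z => z ≠ -(δ : ℂ)) hδ
      (fun z w hz hzw hpm hlt hw => ?_)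
      (fun X hX z hz hm => three_le_skewCodim hX.1 hm (fun h => ?_) (fun h => ?_)) ?_
    -- If w = -δ then z is real, so z = δ, at distance 2 from w, against the strict bound.
    · have hwim : w.im = 0 := by rw [hw]; simp
      obtain ⟨hz1, hw1⟩ := hpm (hzw.2 hwim)
      rw [← hw] at hz
      rcases hz1 with rfl | rfl <;> rcases hw1 with h | h <;>
        first | exact hz h.symm | (rw [h] at hlt; norm_num at hlt)
    · rw [det_neg_of_odd hn, hX.2]
      rcases hδ with rfl | rfl
      · rfl
      · simp [h] at hz
    · rw [hX.2]
      rcases hδ with rfl | rfl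
      · simp [h] at hz
      · rfl
    obtain ⟨m, rfl⟩ := hn
    have he : ∀ i, (![δ, δ, δ] : Fin 3 → ℝ) i = 1 ∨ (![δ, δ, δ] : Fin 3 → ℝ) i = -1 := by
      intro i; fin_cases i <;> simpa using hδ
    -- The eigenvalue δ has odd multiplicity, so it is taken triple; the determinant is δ³ = δ.
    refine exists_mem_orthogonalWithDet
      (M := modelMatrix ![δ, δ, δ] (fun a : Fin (m - 1) => (a : ℕ)))
      (by simp; omega) (modelMatrix_mem_orthogonalGroup he)
      (by rcases hδ with rfl | rfl <;> simp [det_modelMatrix, Fin.prod_univ_succ])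
      (hasDoubleEigenvalue_modelMatrix_real he (i := 0) (i' := 1) (by simp) (by simp)
        (by simpa using hδ0))
      (skewCodim_modelMatrix_le_of_injective he Fin.val_injective ![0, 0, 1] ![1, 2, 2] ?_)
    have hp : ∀ i i' : Fin 3, i < i' → ∃ l : Fin 3,
        (![0, 0, 1] : Fin 3 → Fin 3) l = i ∧ (![1, 2, 2] : Fin 3 → Fin 3) l = i' := by decide
    exact fun i i' h _ => hp i i' h
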